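/- Let $K\ge 3$ arms have categorical feedback distributions $P^{(1)},\dots,P^{(K)}$ on the ordered set $[L]=\{1,\dots,L\}$. For probability vectors $x,y$ on $[L]$ put $\mu(x,y)=\sum_{k=1}^{L}x_k\bigl(\sum_{l=1}^{k}y_l-\tfrac12 y_k\bigr)$, so that $\mu(P^{(i)},P^{(j)})=\mathbb P[X_i>X_j]+\tfrac12\mathbb P[X_i=X_j]$ for independent $X_i\sim P^{(i)}$, $X_j\sim P^{(j)}$. The Borda score of arm $i$ is $B_i=\frac1{K-1}\sum_{j\ne i}\mu(P^{(i)},P^{(j)})$; let $a^*$ be an arm with the largest Borda score (the Borda winner), and put $\Delta_i=B_{a^*}-B_i$, $\Delta_{\mathrm{all}}=\sum_{i\ne a^*}\Delta_i$, $\Delta_{\min}=\min_{i\ne a^*}\Delta_i$. In each round $t=1,2,\dots$ one arm $a_t$ is pulled and independent feedback with distribution $P^{(a_t)}$ is observed; the Borda regret is $R_T=\sum_{t=1}^{T}\Delta_{a_t}$. Borda-UCB with parameter $\alpha>0$ and $\tau\ge1$ initial pulls works as follows. First every arm is pulled $\tau$ times. Then the following step is repeated. Let $t$ be the number of the current round,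 $N_i$ the number of pulls of arm $i$ so far, and $\hat P^{(i)}$ the empirical feedback distribution of arm $i$. Put $\hat B_i=\frac1{K-1}\sum_{k\ne i}\mu(\hat P^{(i)},\hat P^{(k)})$, $\gamma_i=\sqrt{\alpha\log t/N_i}$, $\beta_i=\gamma_i+\frac1{K-1}\sum_{k\ne i}\gamma_k$, let $i_{\mathrm{UCB}}$ be a maximizer of $\hat B_i+\beta_i$ (ties are broken arbitrarily) and $i_{\mathrm{Count}}=\{i: N_i=\max_j N_j\}$. If $i_{\mathrm{UCB}}\in i_{\mathrm{Count}}$, pull $i_{\mathrm{UCB}}$; otherwise pull every arm of $[K]\setminus i_{\mathrm{Count}}$ once, in consecutive rounds. For every $\varepsilon'>0$ with $\varepsilon'\ne1$ set $$\alpha=\max\left(2,\ \frac{3(1+3\varepsilon')^2}{2(1-\varepsilon')^2}\left(\frac{K-1}{K-2}\right)^2\right).$$ Then, for every $\varepsilon>0$ with $2\varepsilon<\Delta_{\min}$ and every $T$, the expected regret of Borda-UCB satisfies $$\mathbb E[R_T]\le\Delta_{\mathrm{all}}\left(\frac{4\alpha}{(\Delta_{\min}-2\varepsilon)^2}\log T+C_\varepsilon+C_{\varepsilon'}\right)$$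 for some constants $C_\varepsilon=O(\varepsilon^{-2})$ as $\varepsilon\to0$ and $C_{\varepsilon'}=O(\varepsilon'^{-2})$ as $\varepsilon'\to0$. Here $C_\varepsilon$ depends only on $\varepsilon,K,L,\tau$, and $C_{\varepsilon'}$ depends only on $\varepsilon',K,L,\tau$ and the gaps $\Delta_1,\dots,\Delta_K$. -/

import Mathlib

open Filter Topology Asymptotics MeasureTheory ProbabilityTheory

noncomputable section

namespace QDB

/-! Arms are indexed by `Fin K`, qualitative feedback takes values in the linearly ordered set
`Fin L`. A family of feedback distributions is `P : Fin K → Fin L → ℝ`, where `P i l` is the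
probability that arm `i` returns feedback `l`. -/

/-- `μ(x, y) = ∑ₖ xₖ (∑_{l ≤ k} y_l - yₖ / 2)`, which is `ℙ[X > Y] + ℙ[X = Y] / 2` for independent
`X ∼ x` and `Y ∼ y`. -/
def mu {L : ℕ} (x y : Fin L → ℝ) : ℝ :=
  ∑ k : Fin L, x k * ((∑ l ∈ Finset.Iic k, y l) - 1 / 2 * y k)

/-- The Borda score `B_i = (K - 1)⁻¹ ∑_{j ≠ i} μ(P_i, P_j)` of arm `i`. -/
def bordaScore {K L : ℕ} (P : Fin K → Fin L → ℝ) (i : Fin K) : ℝ :=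
  1 / ((K : ℝ) - 1) * ∑ j ∈ Finset.univ.erase i, mu (P i) (P j)

/-- Arm `b` is a Borda winner: it has the largest Borda score. -/
def IsBordaWinner {K L : ℕ} (P : Fin K → Fin L → ℝ) (b : Fin K) : Prop :=
  ∀ i, bordaScore P i ≤ bordaScore P b

/-- The gap `Δ_i = B_b - B_i` of arm `i`, where `b` is the Borda winner. -/
def gap {K L : ℕ} (P : Fin K → Fin L → ℝ) (b i : Fin K) : ℝ :=
  bordaScore P b - bordaScore P i

/-- `Δ_all = ∑_{i ≠ b} Δ_i`. -/
def gapAll {K L : ℕ} (P : Fin K → Fin L → ℝ) (b : Fin K) : ℝ :=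
  ∑ i ∈ Finset.univ.erase b, gap P b i

/-- `Δ_min = min_{i ≠ b} Δ_i` (a minimum over a finite set, nonempty when `K ≥ 2`). -/
def gapMin {K L : ℕ} (P : Fin K → Fin L → ℝ) (b : Fin K) : ℝ :=
  ⨅ i : {i : Fin K // i ≠ b}, gap P b i

/-- The Borda regret `R_T = Δ_{a_1} + ⋯ + Δ_{a_T}` of a sequence of pulls. Rounds are numbered from
zero: `a t` is the arm pulled in the `(t + 1)`-st round. -/
def regret {K L : ℕ} (P : Fin K → Fin L → ℝ) (b : Fin K) (a : ℕ → Fin K) (T : ℕ) : ℝ :=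
  ∑ t ∈ Finset.range T, gap P b (a t)

/-- `N_i`: the number of times arm `i` was pulled in the first `t` rounds. -/
def pulls {K : ℕ} (a : ℕ → Fin K) (t : ℕ) (i : Fin K) : ℕ :=
  ((Finset.range t).filter fun s => a s = i).card

/-- The feedback received in round `t` when the `(m + 1)`-st pull of arm `i` returns `x i m`. -/
def feedback {K L : ℕ} (x : Fin K → ℕ → Fin L) (a : ℕ → Fin K) (t : ℕ) : Fin L :=
  x (a t) (pulls a t (a t))

/-- `C^{(i)}_l`: how often feedback `l` was received from arm `i` in the first `t` rounds. -/
def feedbackCount {K L : ℕ} (a : ℕ → Fin K) (r : ℕ → Fin L) (t : ℕ) (i : Fin K) (l : Fin L) : ℕ :=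
  ((Finset.range t).filter fun s => a s = i ∧ r s = l).card

/-- The empirical feedback distributions `C^{(i)} / N_i` after `t` rounds. -/
def empirical {K L : ℕ} (a : ℕ → Fin K) (r : ℕ → Fin L) (t : ℕ) (i : Fin K) (l : Fin L) : ℝ :=
  (feedbackCount a r t i l : ℝ) / (pulls a t i : ℝ)

/-- `γ_i = √(α log t / N_i)`, at the beginning of the `(t + 1)`-st round. -/
def gammaWidth {K : ℕ} (α : ℝ) (a : ℕ → Fin K) (t : ℕ) (i : Fin K) : ℝ :=
  Real.sqrt (α * Real.log ((t : ℝ) + 1) / (pulls a t i : ℝ))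

/-- The width of the confidence interval `β_i = γ_i + (K - 1)⁻¹ ∑_{k ≠ i} γ_k`. -/
def betaWidth {K : ℕ} (α : ℝ) (a : ℕ → Fin K) (t : ℕ) (i : Fin K) : ℝ :=
  gammaWidth α a t i + 1 / ((K : ℝ) - 1) * ∑ k ∈ Finset.univ.erase i, gammaWidth α a t k

/-- The upper confidence bound: the estimated Borda score plus `β_i`. -/
def ucb {K L : ℕ} (α : ℝ) (a : ℕ → Fin K) (r : ℕ → Fin L) (t : ℕ) (i : Fin K) : ℝ :=
  bordaScore (empirical a r t) i + betaWidth α a t i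

/-- `i_Count`: the set of arms that were pulled the most in the first `t` rounds. -/
def mostPulled {K : ℕ} (a : ℕ → Fin K) (t : ℕ) : Set (Fin K) :=
  {i | ∀ j, pulls a t j ≤ pulls a t i}

/-- The pulls `a` with feedback `r` are a run of Borda-UCB with parameter `α` and `τ` initial pulls
of each arm. The loop is entered for the `s`-th time (`s = 0, 1, …`) after `σ s` rounds; `u` is an
arm with the largest upper confidence bound, ties being broken arbitrarily. If `u` is among the
most pulled arms it is pulled once, otherwise all arms which are not among the most pulled ones are
pulled once each, in any order and in as many consecutive rounds. -/
structure IsBordaUCBRun {K L : ℕ} (α : ℝ) (τ : ℕ) (a : ℕ → Fin K) (r : ℕ → Fin L) : Prop where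
  initial : ∀ i, pulls a (K * τ) i = τ
  loop : ∃ σ : ℕ → ℕ, σ 0 = K * τ ∧ ∀ s, ∃ u : Fin K,
    (∀ i, ucb α a r (σ s) i ≤ ucb α a r (σ s) u) ∧
    ((u ∈ mostPulled a (σ s) ∧ a (σ s) = u ∧ σ (s + 1) = σ s + 1) ∨
      (u ∉ mostPulled a (σ s) ∧
        Set.BijOn a (Set.Ico (σ s) (σ (s + 1))) (mostPulled a (σ s))ᶜ))

/-- `α = max(2, 3(1+3ε')² / (2(1-ε')²) · ((K-1)/(K-2))²)`. -/
def bordaAlpha (K : ℕ) (ε' : ℝ) : ℝ :=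
  max 2 (3 * (1 + 3 * ε') ^ 2 / (2 * (1 - ε') ^ 2) * (((K : ℝ) - 1) / ((K : ℝ) - 2)) ^ 2)

end QDB

end

/-!
The analysis is pathwise on the table of feedback `X i m`, so it holds for every rule for breaking
ties, even one that looks into the future.

*Counting.* Whenever the loop is entered, one arm (the leader) has `n` pulls and all the others have
the same number `m ≤ n` (`pulls_step`). Let `b` be the Borda winner. A suboptimal arm can only gain
pulls in three ways: as a leader, as a follower of a suboptimal leader, in which case its count
stays below that of the leader, or as a follower of `b`. Hence its count is at most
`τ + M + #(leader errors) + #(challenger errors)` (`pulls_le_of_run`): a leader error is a pair of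
counts `(n, m)` at which a suboptimal leader has a larger upper confidence bound than `b`, and a
challenger error is one at which `b` leads, `m ≥ M`, and some other arm has the larger bound.

*Concentration.* McDiarmid's inequality (`measureReal_ge_le_of_bounded_differences`) applies to the
difference of two empirical Borda scores. The number of samples of each arm being fixed, the
difference is an unbiased estimator, and the arms which are not compared contribute only
`1 / (K - 1)` each to the sensitivity. The widths of leader and follower differ by
`(K - 2) / (K - 1) · (γ_m - γ_n)`, and `((K - 2) / (K - 1))² α ≥ 3 / 2` for every `ε'`.

*Leader errors.* A suboptimal leader with gap `d` must be overestimated by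
`d + (K - 2) / (K - 1) · (γ_m - γ_n)`. For `n` large compared to `m` the probability of this is at
most `n ^ (-51/50) · exp (-d² m / 2)`, and otherwise it is exponentially small in `n`; both are
summable over `(n, m)`. This is where the value of `α` matters: with cruder sensitivities the
exponent of `n` would not be below `-1` for `K = 3`.

*Challenger errors.* For `m ≥ M ≥ 4 α log T / (Δ_min - 2ε)²` the width of a challenger is at most
half of its gap `d`, so that an error needs a deviation of `d / 2`. Its probability is at most
`T⁻¹ exp (-d² (m - M) / 10)`, where `T⁻¹` absorbs the union over `n < T`.

The expected number of errors is thus bounded in terms of the gaps alone, and `C = τ + 2` and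
`C' = ∑ i, errorBound (Δ i)` can be taken independent of `ε` and `ε'`.
-/

noncomputable section

namespace QDB

/-! ### The bounded differences inequality -/

section McDiarmid

variable {A : Type*} [Finite A] [MeasurableSpace A] [MeasurableSingletonClass A]

/-- Hoeffding's lemma, in terms of the oscillation of the variable. -/
lemma integral_exp_le_of_oscillation_le (ν : Measure A) [IsProbabilityMeasure ν] {g : A → ℝ}
    {c : ℝ} (hg : ∀ a a', g a - g a' ≤ c) :
    ∫ a, Real.exp (g a) ∂ν ≤ Real.exp (∫ a, g a ∂ν + c ^ 2 / 8) := by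
  have : Nonempty A := nonempty_of_isProbabilityMeasure ν
  obtain ⟨a₀, h₀⟩ := Finite.exists_min g
  have hc : 0 ≤ c := by simpa using hg a₀ a₀
  have h := hasSubgaussianMGF_of_mem_Icc (μ := ν) (X := g) (a := g a₀) (b := g a₀ + c)
    (Measurable.of_discrete).aemeasurable
    (ae_of_all _ fun a => ⟨h₀ a, by linarith [hg a a₀]⟩)
  have h1 := h.mgf_le 1
  simp only [mgf, one_mul, Real.exp_sub, integral_div] at h1
  rw [div_le_iff₀ (Real.exp_pos _), ← Real.exp_add] at h1
  refine h1.trans (Real.exp_le_exp.2 (le_of_eq ?_))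
  simp [abs_of_nonneg hc]
  ring

lemma integral_pi_fin_succ {N : ℕ} (ν : Fin (N + 1) → Measure A)
    [∀ j, IsProbabilityMeasure (ν j)] (f : (Fin (N + 1) → A) → ℝ) :
    ∫ x, f x ∂Measure.pi ν =
      ∫ a, ∫ y, f (Fin.cons a y) ∂Measure.pi (fun j => ν j.succ) ∂ν 0 := by
  have h := ((measurePreserving_piFinSuccAbove ν 0).symm).integral_comp'
    (g := f)
  rw [← h, integral_prod _ Integrable.of_finite]
  simp [MeasurableEquiv.piFinSuccAbove, Fin.insertNthEquiv]

/-- The moment generating function bound behind McDiarmid's inequality. The induction integrates out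
the coordinates other than the first one; the resulting function of the first coordinate still has
oscillation at most `c 0`, so that Hoeffding's lemma applies to it. -/
lemma integral_exp_pi_fin_le {N : ℕ} (ν : Fin N → Measure A)
    [∀ j, IsProbabilityMeasure (ν j)] (f : (Fin N → A) → ℝ) (c : Fin N → ℝ)
    (hf : ∀ j x a a', f (Function.update x j a) - f (Function.update x j a') ≤ c j) :
    ∫ x, Real.exp (f x) ∂Measure.pi ν ≤
      Real.exp (∫ x, f x ∂Measure.pi ν + (∑ j, c j ^ 2) / 8) := by
  induction N with
  | zero =>
    rw [Measure.pi_of_empty ν (fun j => j.elim0)]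
    simp
  | succ N ih =>
    rw [integral_pi_fin_succ, integral_pi_fin_succ, Fin.sum_univ_succ]
    set π := Measure.pi fun j : Fin N => ν j.succ
    calc ∫ a, ∫ y, Real.exp (f (Fin.cons a y)) ∂π ∂ν 0
        ≤ ∫ a, Real.exp (∫ y, f (Fin.cons a y) ∂π + (∑ j : Fin N, c j.succ ^ 2) / 8) ∂ν 0 := by
          refine integral_mono .of_finite .of_finite fun a => ?_
          refine ih (fun j => ν j.succ) (fun y => f (Fin.cons a y)) (fun j => c j.succ)
            fun j x b b' => ?_
          simpa only [Fin.cons_update] using hf j.succ (Fin.cons a x) b b'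
      _ ≤ _ := by
          simp only [Real.exp_add]
          rw [integral_mul_const]
          refine (mul_le_mul_of_nonneg_right (integral_exp_le_of_oscillation_le (c := c 0) (ν 0)
            fun a a' => ?_) (Real.exp_pos _).le).trans (le_of_eq ?_)
          · rw [← integral_sub .of_finite .of_finite]
            refine (integral_mono .of_finite (integrable_const (c 0)) fun y => ?_).trans ?_
            · have := hf 0 (Fin.cons a y) a a'
              simpa only [Fin.update_cons_zero] using this
            · simp
          · rw [← Real.exp_add, ← Real.exp_add]
            ring_nf

lemma integral_exp_pi_le {ι : Type*} [Fintype ι] [DecidableEq ι] (ν : ι → Measure A)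
    [∀ j, IsProbabilityMeasure (ν j)] (f : (ι → A) → ℝ) (c : ι → ℝ)
    (hf : ∀ j x a a', f (Function.update x j a) - f (Function.update x j a') ≤ c j) :
    ∫ x, Real.exp (f x) ∂Measure.pi ν ≤
      Real.exp (∫ x, f x ∂Measure.pi ν + (∑ j, c j ^ 2) / 8) := by
  let e : Fin (Fintype.card ι) ≃ ι := (Fintype.equivFin ι).symm
  have hmp := measurePreserving_piCongrLeft (α := fun _ : ι => A) ν e
  rw [← hmp.integral_comp', ← hmp.integral_comp', ← e.sum_comp]
  refine integral_exp_pi_fin_le _ _ _ fun j x a a' => ?_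
  have hu : ∀ a, (MeasurableEquiv.piCongrLeft (fun _ : ι => A) e) (Function.update x j a) =
      Function.update (MeasurableEquiv.piCongrLeft (fun _ : ι => A) e x) (e j) a := by
    intro a
    ext i
    obtain ⟨k, rfl⟩ := e.surjective i
    rw [MeasurableEquiv.piCongrLeft_apply_apply]
    by_cases hk : k = j
    · subst hk; simp
    · rw [Function.update_of_ne hk, Function.update_of_ne (e.injective.ne hk),
        MeasurableEquiv.piCongrLeft_apply_apply]
  rw [hu, hu]
  exact hf _ _ _ _

/-- **McDiarmid's inequality** for independent variables with values in a finite type. -/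
theorem measureReal_ge_le_of_bounded_differences {Ω ι : Type*} [Fintype ι] [DecidableEq ι]
    [MeasurableSpace Ω] {Pr : Measure Ω} [IsProbabilityMeasure Pr] {Y : ι → Ω → A}
    (hY : ∀ j, Measurable (Y j)) (hind : iIndepFun Y Pr) (f : (ι → A) → ℝ) (c : ι → ℝ)
    (hf : ∀ j x a a', f (Function.update x j a) - f (Function.update x j a') ≤ c j)
    {u : ℝ} (hu : 0 ≤ u) {V : ℝ} (hc : ∑ j, c j ^ 2 ≤ V) (hV : 0 < V) :
    Pr.real {ω | (∫ ω', f (fun j => Y j ω') ∂Pr) + u ≤ f (fun j => Y j ω)} ≤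
      Real.exp (-(2 * u ^ 2 / V)) := by
  have hYm : Measurable fun ω j => Y j ω := measurable_pi_lambda _ hY
  have hmap := (iIndepFun_iff_map_fun_eq_pi_map fun j => (hY j).aemeasurable).1 hind
  have hprob : ∀ j, IsProbabilityMeasure (Pr.map (Y j)) := fun j =>
    Measure.isProbabilityMeasure_map (hY j).aemeasurable
  have hint : ∀ g : (ι → A) → ℝ, ∫ ω, g (fun j => Y j ω) ∂Pr =
      ∫ x, g x ∂Measure.pi fun j => Pr.map (Y j) := by
    intro g
    rw [← hmap, integral_map hYm.aemeasurable
      (Measurable.of_discrete).aestronglyMeasurable]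
  have hi : ∀ g : (ι → A) → ℝ, Integrable (fun ω => g (fun j => Y j ω)) Pr := by
    intro g
    exact (Integrable.of_finite (μ := Pr.map fun ω j => Y j ω) (f := g)).comp_measurable hYm
  have hsub : HasSubgaussianMGF
      (fun ω => f (fun j => Y j ω) - ∫ ω', f (fun j => Y j ω') ∂Pr) (V / 4).toNNReal Pr := by
    refine ⟨fun t => hi fun x => Real.exp (t * (f x - ∫ ω', f (fun j => Y j ω') ∂Pr)),
      fun t => ?_⟩
    set E := ∫ ω', f (fun j => Y j ω') ∂Pr with hE
    have h := integral_exp_pi_le (fun j => Pr.map (Y j)) (fun x => t * (f x - E))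
      (fun j => |t| * c j) fun j x a a' => by
        rw [← mul_sub, sub_sub_sub_cancel_right]
        rcases abs_cases t with ⟨h, h'⟩ | ⟨h, h'⟩ <;> rw [h]
        · exact mul_le_mul_of_nonneg_left (hf _ _ _ _) h'
        · have := hf j x a' a
          nlinarith
    rw [mgf, hint fun x => Real.exp (t * (f x - E))]
    refine h.trans (Real.exp_le_exp.2 ?_)
    rw [integral_const_mul, integral_sub .of_finite (integrable_const _), ← hint, ← hE]
    simp only [mul_pow, sq_abs, ← Finset.mul_sum, integral_const, probReal_univ, one_smul,
      sub_self, mul_zero, zero_add]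
    rw [Real.coe_toNNReal _ (by positivity)]
    nlinarith [mul_le_mul_of_nonneg_left hc (sq_nonneg t)]
  have h := hsub.measure_ge_le hu
  rw [Real.coe_toNNReal _ (by positivity)] at h
  refine le_trans (le_of_eq ?_) (h.trans (Real.exp_le_exp.2 (le_of_eq ?_)))
  · congr 1
    ext ω
    simp only [Set.mem_ofPred_eq]
    constructor <;> intro h <;> linarith
  · field_simp
    ring

end McDiarmid

/-! ### The duel kernel and empirical distributions -/

/-- The probability `1`, `1 / 2` or `0` that feedback `k` beats feedback `l` when ties are decided
by a fair coin; `mu` is the bilinear extension of this kernel. -/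
def duel {L : ℕ} (k l : Fin L) : ℝ := if l < k then 1 else if l = k then 1 / 2 else 0

lemma duel_add_swap {L : ℕ} (k l : Fin L) : duel k l + duel l k = 1 := by
  unfold duel
  rcases lt_trichotomy k l with h | h | h
  · simp [h, h.not_gt, h.ne']
  · subst h; norm_num
  · simp [h, h.not_gt, h.ne']

lemma duel_nonneg {L : ℕ} (k l : Fin L) : 0 ≤ duel k l := by
  unfold duel; split_ifs <;> norm_num

lemma duel_le_one {L : ℕ} (k l : Fin L) : duel k l ≤ 1 := by
  unfold duel; split_ifs <;> norm_num

lemma duel_antitone {L : ℕ} (k : Fin L) : Antitone (duel k) := by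
  intro l l' h
  unfold duel
  split_ifs <;> first | (exfalso; omega) | norm_num

/-- The probability that feedback with distribution `x` beats the fixed feedback `l`. -/
def winProb {L : ℕ} (x : Fin L → ℝ) (l : Fin L) : ℝ := ∑ k, x k * duel k l

lemma mu_eq_sum_winProb {L : ℕ} (x y : Fin L → ℝ) : mu x y = ∑ l, y l * winProb x l := by
  have h : ∀ k, (∑ l ∈ Finset.Iic k, y l) - 1 / 2 * y k = ∑ l, y l * duel k l := by
    intro k
    have h1 : Finset.Iic k = insert k (Finset.Iio k) := by ext; simp [le_iff_eq_or_lt]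
    have h2 : ∀ l, y l * duel k l =
        (if l ∈ Finset.Iio k then y l else 0) + if k = l then 1 / 2 * y k else 0 := by
      intro l
      unfold duel
      rcases lt_trichotomy k l with h | h | h
      · simp [h.not_gt, h.ne', h.ne]
      · subst h; simp; ring
      · simp [h, h.ne']
    rw [h1, Finset.sum_insert (by simp), Finset.sum_congr rfl fun l _ => h2 l,
      Finset.sum_add_distrib, Finset.sum_ite_mem, Finset.sum_ite_eq]
    simp
    ring
  simp only [mu, h, winProb, Finset.mul_sum]
  rw [Finset.sum_comm]
  exact Finset.sum_congr rfl fun l _ => Finset.sum_congr rfl fun k _ => by ring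

lemma winProb_antitone {L : ℕ} {x : Fin L → ℝ} (hx : x ∈ stdSimplex ℝ (Fin L)) :
    Antitone (winProb x) := fun _ _ h =>
  Finset.sum_le_sum fun k _ => mul_le_mul_of_nonneg_left (duel_antitone k h) (hx.1 k)

lemma winProb_nonneg {L : ℕ} {x : Fin L → ℝ} (hx : x ∈ stdSimplex ℝ (Fin L)) (l : Fin L) :
    0 ≤ winProb x l :=
  Finset.sum_nonneg fun k _ => mul_nonneg (hx.1 k) (duel_nonneg _ _)

lemma winProb_le_one {L : ℕ} {x : Fin L → ℝ} (hx : x ∈ stdSimplex ℝ (Fin L)) (l : Fin L) :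
    winProb x l ≤ 1 := by
  rw [← hx.2]
  exact Finset.sum_le_sum fun k _ => mul_le_of_le_one_right (hx.1 k) (duel_le_one _ _)

lemma mu_add_swap {L : ℕ} {x y : Fin L → ℝ} (hx : x ∈ stdSimplex ℝ (Fin L))
    (hy : y ∈ stdSimplex ℝ (Fin L)) : mu x y + mu y x = 1 := by
  have h1 : mu y x = ∑ l, ∑ k, y l * x k * duel l k := by
    rw [mu_eq_sum_winProb]
    simp only [winProb, Finset.mul_sum]
    rw [Finset.sum_comm]
    exact Finset.sum_congr rfl fun l _ => Finset.sum_congr rfl fun k _ => by ring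
  have h2 : mu x y = ∑ l, ∑ k, y l * x k * duel k l := by
    rw [mu_eq_sum_winProb]
    simp only [winProb, Finset.mul_sum]
    exact Finset.sum_congr rfl fun l _ => Finset.sum_congr rfl fun k _ => by ring
  rw [h1, h2, ← Finset.sum_add_distrib]
  simp only [← Finset.sum_add_distrib, ← mul_add, duel_add_swap, mul_one, ← Finset.mul_sum,
    hx.2, hy.2]

/-- The empirical distribution of the sample `z`; it is zero for the empty sample. -/
def empDist {L n : ℕ} (z : Fin n → Fin L) (l : Fin L) : ℝ :=
  ((Finset.univ.filter fun q => z q = l).card : ℝ) / n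

lemma sum_empDist_mul {L n : ℕ} (z : Fin n → Fin L) (φ : Fin L → ℝ) :
    ∑ l, empDist z l * φ l = (∑ q, φ (z q)) / n := by
  simp only [empDist, Finset.card_filter, Nat.cast_sum, Nat.cast_ite, Nat.cast_one,
    Nat.cast_zero, div_mul_eq_mul_div, ← Finset.sum_div]
  congr 1
  simp only [Finset.sum_mul]
  rw [Finset.sum_comm]
  exact Finset.sum_congr rfl fun q _ => by simp

lemma empDist_mem_stdSimplex {L n : ℕ} (hn : n ≠ 0) (z : Fin n → Fin L) :
    empDist z ∈ stdSimplex ℝ (Fin L) := by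
  refine ⟨fun l => by unfold empDist; positivity, ?_⟩
  have h := sum_empDist_mul z fun _ => 1
  simp only [mul_one, Finset.sum_const, Finset.card_univ, Fintype.card_fin, nsmul_eq_mul] at h
  rw [h, div_self (Nat.cast_ne_zero.2 hn)]

lemma mu_empDist_right {L n : ℕ} (x : Fin L → ℝ) (z : Fin n → Fin L) :
    mu x (empDist z) = (∑ q, winProb x (z q)) / n := by
  rw [mu_eq_sum_winProb, sum_empDist_mul]

lemma mu_empDist_update_sub {L n : ℕ} (x : Fin L → ℝ) (z : Fin n → Fin L) (q : Fin n)
    (a a' : Fin L) :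
    mu x (empDist (Function.update z q a)) - mu x (empDist (Function.update z q a')) =
      (winProb x a - winProb x a') / n := by
  have h : ∀ a, ∑ r, winProb x (Function.update z q a r) =
      winProb x a + ∑ r ∈ Finset.univ.erase q, winProb x (z r) := by
    intro a
    rw [← Finset.add_sum_erase _ _ (Finset.mem_univ q), Function.update_self]
    congr 1
    exact Finset.sum_congr rfl fun r hr => by
      rw [Function.update_of_ne (Finset.ne_of_mem_erase hr)]
  rw [mu_empDist_right, mu_empDist_right, h, h]
  ring

/-! ### Sensitivity of the Borda scores -/

lemma bordaScore_update_of_ne {K L : ℕ} (P : Fin K → Fin L → ℝ) {i j : Fin K} (hij : j ≠ i)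
    (x y : Fin L → ℝ) :
    bordaScore (Function.update P i x) j - bordaScore (Function.update P i y) j =
      1 / ((K : ℝ) - 1) * (mu (P j) x - mu (P j) y) := by
  have hi : i ∈ Finset.univ.erase j := by simp [hij.symm]
  have h : ∀ x, ∑ k ∈ Finset.univ.erase j,
      mu (Function.update P i x j) (Function.update P i x k) =
      mu (P j) x + ∑ k ∈ (Finset.univ.erase j).erase i, mu (P j) (P k) := by
    intro x
    rw [← Finset.add_sum_erase _ _ hi, Function.update_self, Function.update_of_ne hij]
    congr 1
    exact Finset.sum_congr rfl fun r hr => by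
      rw [Function.update_of_ne (Finset.ne_of_mem_erase hr)]
  rw [bordaScore, bordaScore, h, h]
  ring

lemma bordaScore_update_self {K L : ℕ} (P : Fin K → Fin L → ℝ)
    (hP : ∀ i, P i ∈ stdSimplex ℝ (Fin L)) (i : Fin K)
    {x y : Fin L → ℝ} (hx : x ∈ stdSimplex ℝ (Fin L)) (hy : y ∈ stdSimplex ℝ (Fin L)) :
    bordaScore (Function.update P i x) i - bordaScore (Function.update P i y) i =
      -(1 / ((K : ℝ) - 1) * ∑ k ∈ Finset.univ.erase i, (mu (P k) x - mu (P k) y)) := by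
  have h : ∀ x, ∑ k ∈ Finset.univ.erase i,
      mu (Function.update P i x i) (Function.update P i x k) =
      ∑ k ∈ Finset.univ.erase i, mu x (P k) := by
    intro x
    exact Finset.sum_congr rfl fun r hr => by
      rw [Function.update_self, Function.update_of_ne (Finset.ne_of_mem_erase hr)]
  rw [bordaScore, bordaScore, h, h, ← mul_sub, ← mul_neg, ← Finset.sum_sub_distrib,
    ← Finset.sum_neg_distrib]
  congr 1
  exact Finset.sum_congr rfl fun k _ => by
    linarith [mu_add_swap hx (hP k), mu_add_swap hy (hP k)]

/-- A bound for the change of `B_i - B_j` when the distribution of arm `k` moves from one point mass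
to another. Each of the arms `i` and `j` enters `K` duels of the difference, any other arm only two
whose changes have the same sign and therefore partly cancel: the bound is `1 / (K - 1)` and not
`2 / (K - 1)`. -/
def sensitivity {K : ℕ} (i j k : Fin K) : ℝ :=
  if k = i ∨ k = j then (K : ℝ) / ((K : ℝ) - 1) else 1 / ((K : ℝ) - 1)

/-- The hypotheses say that `x` is stochastically smaller than `y`: every opponent `z` wins at least
as often against `x`, and by at most `θ` more often. -/
lemma abs_scoreDiff_update_sub_le {K L : ℕ} (hK : 2 ≤ K) (P : Fin K → Fin L → ℝ)
    (hP : ∀ i, P i ∈ stdSimplex ℝ (Fin L)) {i j : Fin K} (hij : i ≠ j) (k : Fin K)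
    {x y : Fin L → ℝ} (hx : x ∈ stdSimplex ℝ (Fin L)) (hy : y ∈ stdSimplex ℝ (Fin L)) {θ : ℝ}
    (h0 : ∀ z ∈ stdSimplex ℝ (Fin L), 0 ≤ mu z x - mu z y)
    (h1 : ∀ z ∈ stdSimplex ℝ (Fin L), mu z x - mu z y ≤ θ) :
    |(bordaScore (Function.update P k x) i - bordaScore (Function.update P k x) j) -
      (bordaScore (Function.update P k y) i - bordaScore (Function.update P k y) j)| ≤
      θ * sensitivity i j k := by
  have hK' : (0 : ℝ) < (K : ℝ) - 1 := by
    have : (2 : ℝ) ≤ K := by exact_mod_cast hK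
    linarith
  have hne : ∀ j, j ≠ k → 0 ≤ bordaScore (Function.update P k x) j -
      bordaScore (Function.update P k y) j ∧ bordaScore (Function.update P k x) j -
      bordaScore (Function.update P k y) j ≤ θ * (1 / ((K : ℝ) - 1)) := by
    intro j hj
    rw [bordaScore_update_of_ne P hj, mul_comm θ]
    exact ⟨mul_nonneg (by positivity) (h0 _ (hP j)),
      mul_le_mul_of_nonneg_left (h1 _ (hP j)) (by positivity)⟩
  have hself : bordaScore (Function.update P k x) k -
      bordaScore (Function.update P k y) k ≤ 0 ∧ -θ ≤ bordaScore (Function.update P k x) k -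
      bordaScore (Function.update P k y) k := by
    rw [bordaScore_update_self P hP k hx hy]
    constructor
    · exact neg_nonpos.2 (mul_nonneg (by positivity)
        (Finset.sum_nonneg fun l _ => h0 _ (hP l)))
    · have : ∑ l ∈ Finset.univ.erase k, (mu (P l) x - mu (P l) y) ≤ ((K : ℝ) - 1) * θ := by
        refine (Finset.sum_le_sum fun l _ => h1 _ (hP l)).trans (le_of_eq ?_)
        rw [Finset.sum_const, Finset.card_erase_of_mem (Finset.mem_univ k), Finset.card_univ,
          Fintype.card_fin, nsmul_eq_mul, Nat.cast_sub (by omega), Nat.cast_one]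
      rw [neg_le_neg_iff, one_div, inv_mul_le_iff₀ hK']
      exact this
  have hsplit : (K : ℝ) / ((K : ℝ) - 1) = 1 + 1 / ((K : ℝ) - 1) := by field_simp; ring
  unfold sensitivity
  by_cases hki : k = i
  · subst hki
    have := hne j hij.symm
    rw [if_pos (Or.inl rfl), hsplit, abs_le]
    constructor <;> linarith
  · by_cases hkj : k = j
    · subst hkj
      have := hne i hij
      rw [if_pos (Or.inr rfl), hsplit, abs_le]
      constructor <;> linarith
    · have hi := hne i (Ne.symm hki)
      have hj := hne j (Ne.symm hkj)
      rw [if_neg (by tauto), abs_le]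
      constructor <;> linarith

/-! ### Empirical scores -/

/-- The estimated Borda score of arm `i` from `c k` samples of each arm `k`, where `z ⟨k, q⟩` is the
`q`-th sample of arm `k`. -/
def sampleScore {K L : ℕ} (c : Fin K → ℕ) (i : Fin K)
    (z : (Σ k : Fin K, Fin (c k)) → Fin L) : ℝ :=
  bordaScore (fun k => empDist fun q => z ⟨k, q⟩) i

/-- The estimated Borda score of arm `i` from the first `c k` entries of each row `x k` of a table
of feedback. -/
def empScore {K L : ℕ} (c : Fin K → ℕ) (x : Fin K → ℕ → Fin L) (i : Fin K) : ℝ :=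
  sampleScore c i fun s => x s.1 s.2

/-- Replacing one of the `c k` samples of arm `k` changes the estimate of `B_i - B_j` by at most
`sensitivity i j k / c k`. A larger feedback makes every opponent less successful, hence one of the
two samples dominates the other and `abs_scoreDiff_update_sub_le` applies. -/
lemma sampleScore_sub_update_sub_le {K L : ℕ} (hK : 2 ≤ K) {c : Fin K → ℕ} (hc : ∀ k, c k ≠ 0)
    {i j : Fin K} (hij : i ≠ j) (s : Σ k : Fin K, Fin (c k))
    (z : (Σ k : Fin K, Fin (c k)) → Fin L) (a a' : Fin L) :
    (sampleScore c i (Function.update z s a) - sampleScore c j (Function.update z s a)) -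
      (sampleScore c i (Function.update z s a') - sampleScore c j (Function.update z s a')) ≤
      sensitivity i j s.1 / c s.1 := by
  obtain ⟨k, q⟩ := s
  have hupd : ∀ a, (fun k' => empDist fun q' => Function.update z ⟨k, q⟩ a ⟨k', q'⟩) =
      Function.update (fun k' => empDist fun q' => z ⟨k', q'⟩) k
        (empDist (Function.update (fun q' => z ⟨k, q'⟩) q a)) := by
    intro a
    ext k' : 1
    by_cases hk : k' = k
    · subst hk
      rw [Function.update_self]
      congr 1
      ext q' : 1
      by_cases hq : q' = q
      · subst hq; simp
      · rw [Function.update_of_ne hq, Function.update_of_ne (by simpa using hq)]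
    · rw [Function.update_of_ne hk]
      congr 1
      ext q' : 1
      rw [Function.update_of_ne]
      simp [hk]
  have hP : ∀ k', (empDist fun q' : Fin (c k') => z ⟨k', q'⟩) ∈ stdSimplex ℝ (Fin L) :=
    fun k' => empDist_mem_stdSimplex (hc k') _
  have hcpos : (0 : ℝ) < c k := Nat.cast_pos.2 (Nat.pos_of_ne_zero (hc k))
  have key : ∀ a a' : Fin L, a ≤ a' → 
      |(sampleScore c i (Function.update z ⟨k, q⟩ a) -
        sampleScore c j (Function.update z ⟨k, q⟩ a)) -
      (sampleScore c i (Function.update z ⟨k, q⟩ a') -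
        sampleScore c j (Function.update z ⟨k, q⟩ a'))| ≤ sensitivity i j k / c k := by
    intro a a' haa
    unfold sampleScore
    rw [hupd, hupd, div_eq_inv_mul]
    refine abs_scoreDiff_update_sub_le hK _ hP hij k (empDist_mem_stdSimplex (hc k) _)
      (empDist_mem_stdSimplex (hc k) _) (fun w hw => ?_) (fun w hw => ?_)
    · rw [mu_empDist_update_sub]
      exact div_nonneg (sub_nonneg.2 (winProb_antitone hw haa)) hcpos.le
    · rw [mu_empDist_update_sub, div_eq_inv_mul]
      refine mul_le_of_le_one_right (by positivity) ?_
      linarith [winProb_le_one hw a, winProb_nonneg hw a']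
  rcases le_total a a' with h | h
  · exact (le_abs_self _).trans (key a a' h)
  · rw [← neg_sub]
    exact (neg_le_abs _).trans (key a' a h)

/-- The pull counts which are `n` for arm `i`, the leader, and `m` for every other arm. -/
def leaderCount {K : ℕ} (i : Fin K) (n m : ℕ) : Fin K → ℕ := Function.update (fun _ => m) i n

lemma sum_sensitivity_sq {K : ℕ} (hK : 2 ≤ K) {l i j : Fin K} (hij : i ≠ j) {n m : ℕ}
    (hl : l = i ∨ l = j) (hn : n ≠ 0) (hm : m ≠ 0) :
    ∑ s : (Σ k : Fin K, Fin (leaderCount l n m k)),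
      (sensitivity i j s.1 / leaderCount l n m s.1) ^ 2 =
    ((K : ℝ) / (K - 1)) ^ 2 / n + ((K : ℝ) + 2) / (K - 1) / m := by
  have hK' : (K : ℝ) - 1 ≠ 0 := by
    have : (2 : ℝ) ≤ K := by exact_mod_cast hK
    linarith
  have hn' : (n : ℝ) ≠ 0 := Nat.cast_ne_zero.2 hn
  have hm' : (m : ℝ) ≠ 0 := Nat.cast_ne_zero.2 hm
  have hc : ∀ k, (leaderCount l n m k : ℝ) ≠ 0 := by
    intro k
    unfold leaderCount
    by_cases h : k = l
    · subst h; simpa using hn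
    · simpa [h] using hm
  rw [Fintype.sum_sigma]
  have h1 : ∀ k, ∑ _q : Fin (leaderCount l n m k),
      (sensitivity i j k / leaderCount l n m k) ^ 2 =
      sensitivity i j k ^ 2 / leaderCount l n m k := by
    intro k
    rw [Finset.sum_const, Finset.card_univ, Fintype.card_fin, nsmul_eq_mul]
    have := hc k
    field_simp
  simp only [h1]
  have hrest : ∀ k ∈ (Finset.univ.erase i).erase j,
      sensitivity i j k ^ 2 / (leaderCount l n m k : ℝ) = (1 / ((K : ℝ) - 1)) ^ 2 / m := by
    intro k hk
    simp only [Finset.mem_erase, Finset.mem_univ, and_true] at hk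
    have hkl : k ≠ l := by rcases hl with rfl | rfl <;> tauto
    simp [sensitivity, leaderCount, hk, hkl]
  have hcard : (((Finset.univ.erase i).erase j).card : ℝ) = (K : ℝ) - 2 := by
    rw [Finset.card_erase_of_mem (by simpa using hij.symm),
      Finset.card_erase_of_mem (Finset.mem_univ i), Finset.card_univ, Fintype.card_fin,
      Nat.sub_sub, Nat.cast_sub hK]
    norm_num
  rw [← Finset.add_sum_erase _ _ (Finset.mem_univ i),
    ← Finset.add_sum_erase _ _ (show j ∈ Finset.univ.erase i by simpa using hij.symm),
    Finset.sum_congr rfl hrest, Finset.sum_const, nsmul_eq_mul, hcard]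
  rcases hl with rfl | rfl
  · simp only [sensitivity, leaderCount, true_or, or_true, if_true, Function.update_self,
      Function.update_of_ne hij.symm]
    field_simp
    ring
  · simp only [sensitivity, leaderCount, true_or, or_true, if_true, Function.update_self,
      Function.update_of_ne hij]
    field_simp
    ring

/-! ### Concentration of the empirical Borda scores -/

lemma integral_mu_empDist {L n m : ℕ} {Ω : Type*} [MeasurableSpace Ω] {Pr : Measure Ω}
    [IsProbabilityMeasure Pr] {x y : Fin L → ℝ} (hn : n ≠ 0) (hm : m ≠ 0)
    {Y : Fin n → Ω → Fin L} {Z : Fin m → Ω → Fin L} (hY : ∀ q, Measurable (Y q))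
    (hZ : ∀ r, Measurable (Z r)) (hind : ∀ q r, IndepFun (Y q) (Z r) Pr)
    (hYx : ∀ q l, Pr.real {ω | Y q ω = l} = x l) (hZy : ∀ r l, Pr.real {ω | Z r ω = l} = y l) :
    ∫ ω, mu (empDist fun q => Y q ω) (empDist fun r => Z r ω) ∂Pr = mu x y := by
  have hmu : ∀ (u : Fin n → Fin L) (v : Fin m → Fin L),
      mu (empDist u) (empDist v) = (∑ r, (∑ q, duel (u q) (v r)) / n) / m := by
    intro u v
    rw [mu_empDist_right]
    simp only [winProb]
    congr 1
    exact Finset.sum_congr rfl fun r _ => sum_empDist_mul u fun k => duel k (v r)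
  have hfin : ∀ q r, Integrable (fun ω => duel (Y q ω) (Z r ω)) Pr := by
    intro q r
    exact (Integrable.of_finite (μ := Pr.map fun ω => (Y q ω, Z r ω))
      (f := fun p : Fin L × Fin L => duel p.1 p.2)).comp_measurable
      ((hY q).prodMk (hZ r))
  have hone : ∀ q r, ∫ ω, duel (Y q ω) (Z r ω) ∂Pr = mu x y := by
    intro q r
    have hpY := Measure.isProbabilityMeasure_map (μ := Pr) (hY q).aemeasurable
    have hpZ := Measure.isProbabilityMeasure_map (μ := Pr) (hZ r).aemeasurable
    have h1 := integral_map (μ := Pr) ((hY q).prodMk (hZ r)).aemeasurable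
      (f := fun p : Fin L × Fin L => duel p.1 p.2)
      (Measurable.of_discrete).aestronglyMeasurable
    rw [← h1, (indepFun_iff_map_prod_eq_prod_map_map (hY q).aemeasurable
      (hZ r).aemeasurable).1 (hind q r), integral_prod_symm _ .of_finite,
      integral_fintype .of_finite, mu_eq_sum_winProb]
    refine Finset.sum_congr rfl fun l _ => ?_
    rw [map_measureReal_apply (hZ r) (measurableSet_singleton l), smul_eq_mul,
      integral_fintype .of_finite]
    congr 1
    · exact hZy r l
    · refine Finset.sum_congr rfl fun k _ => ?_
      rw [map_measureReal_apply (hY q) (measurableSet_singleton k), smul_eq_mul]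
      congr 1
      exact hYx q k
  simp only [hmu]
  rw [integral_div, integral_finsetSum _ fun r _ =>
    (integrable_finsetSum _ fun q _ => hfin q r).div_const _]
  simp only [integral_div, integral_finsetSum _ fun q _ => hfin q _, hone]
  have hn' : (n : ℝ) ≠ 0 := Nat.cast_ne_zero.2 hn
  have hm' : (m : ℝ) ≠ 0 := Nat.cast_ne_zero.2 hm
  simp
  field_simp

section Table

variable {K L : ℕ} {Ω : Type*} [MeasurableSpace Ω] {Pr : Measure Ω} [IsProbabilityMeasure Pr]
  {P : Fin K → Fin L → ℝ} {X : Fin K → ℕ → Ω → Fin L}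

lemma measurable_empScore_comp (hX : ∀ i m, Measurable (X i m)) (c : Fin K → ℕ) (i : Fin K) :
    Measurable fun ω => empScore c (fun j q => X j q ω) i := by
  have h : Measurable fun ω => fun s : (Σ k : Fin K, Fin (c k)) => X s.1 s.2 ω :=
    measurable_pi_lambda _ fun s => hX _ _
  have hg : Measurable (sampleScore (L := L) c i) := .of_discrete
  exact hg.comp h

/-- The empirical Borda scores are unbiased, because distinct arms use distinct table entries. -/
lemma integral_empScore (hX : ∀ i m, Measurable (X i m))
    (hind : iIndepFun (fun p : Fin K × ℕ => X p.1 p.2) Pr)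
    (hP : ∀ i m l, Pr.real {ω | X i m ω = l} = P i l) {c : Fin K → ℕ} (hc : ∀ k, c k ≠ 0)
    (i : Fin K) :
    Integrable (fun ω => empScore c (fun j q => X j q ω) i) Pr ∧
    ∫ ω, empScore c (fun j q => X j q ω) i ∂Pr = bordaScore P i := by
  have hm : Measurable fun ω => fun s : (Σ k : Fin K, Fin (c k)) => X s.1 s.2 ω :=
    measurable_pi_lambda _ fun s => hX _ _
  have hint : ∀ g : ((Σ k : Fin K, Fin (c k)) → Fin L) → ℝ,
      Integrable (fun ω => g fun s => X s.1 s.2 ω) Pr := fun g =>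
    (Integrable.of_finite (μ := Pr.map fun ω => fun s : (Σ k : Fin K, Fin (c k)) =>
      X s.1 s.2 ω) (f := g)).comp_measurable hm
  refine ⟨hint (sampleScore c i), ?_⟩
  unfold empScore sampleScore bordaScore
  rw [integral_const_mul, integral_finsetSum]
  · congr 1
    refine Finset.sum_congr rfl fun j hj => ?_
    refine integral_mu_empDist (hc i) (hc j) (fun q => hX _ _) (fun q => hX _ _)
      (fun q r => ?_) (fun q l => hP _ _ _) (fun q l => hP _ _ _)
    exact hind.indepFun (i := (i, (q : ℕ))) (j := (j, (r : ℕ)))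
      (by simp [(Finset.ne_of_mem_erase hj).symm])
  · intro j _
    exact hint fun z => mu (empDist fun q => z ⟨i, q⟩) (empDist fun q => z ⟨j, q⟩)

/-- Concentration of the estimate of `B_i - B_j`, when one of the two arms is the leader with `n`
samples and every other arm has `m` samples. -/
lemma measureReal_empScore_sub_ge_le (hK : 2 ≤ K) (hX : ∀ i m, Measurable (X i m))
    (hind : iIndepFun (fun p : Fin K × ℕ => X p.1 p.2) Pr)
    (hP : ∀ i m l, Pr.real {ω | X i m ω = l} = P i l) {l i j : Fin K} (hij : i ≠ j)
    (hl : l = i ∨ l = j) {n m : ℕ} (hn : n ≠ 0) (hm : m ≠ 0) {u V : ℝ} (hu : 0 ≤ u)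
    (hV : ((K : ℝ) / (K - 1)) ^ 2 / n + ((K : ℝ) + 2) / (K - 1) / m ≤ V) :
    Pr.real {ω | bordaScore P i - bordaScore P j + u ≤
        empScore (leaderCount l n m) (fun k q => X k q ω) i -
          empScore (leaderCount l n m) (fun k q => X k q ω) j} ≤
      Real.exp (-(2 * u ^ 2 / V)) := by
  have hc : ∀ k, leaderCount l n m k ≠ 0 := by
    intro k
    unfold leaderCount
    by_cases h : k = l
    · subst h; simpa using hn
    · simpa [h] using hm
  have hKpos : (0 : ℝ) < (K : ℝ) - 1 := by
    have : (2 : ℝ) ≤ K := by exact_mod_cast hK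
    linarith
  have hVpos : 0 < V := lt_of_lt_of_le (by positivity) hV
  have hi := integral_empScore hX hind hP hc i
  have hj := integral_empScore hX hind hP hc j
  have h := measureReal_ge_le_of_bounded_differences (Pr := Pr)
    (Y := fun (s : Σ k : Fin K, Fin (leaderCount l n m k)) => X s.1 s.2)
    (fun s => hX _ _)
    (hind.precomp (g := fun s : (Σ k : Fin K, Fin (leaderCount l n m k)) => (s.1, (s.2 : ℕ)))
      (by rintro ⟨k, q⟩ ⟨k', q'⟩ h
          simp only [Prod.mk.injEq] at h
          obtain ⟨rfl, h⟩ := h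
          simp [Fin.ext_iff, h]))
    (fun z => sampleScore (leaderCount l n m) i z - sampleScore (leaderCount l n m) j z) _
    (sampleScore_sub_update_sub_le hK hc hij) hu
    ((sum_sensitivity_sq hK hij hl hn hm).le.trans hV) hVpos
  have hE := integral_sub hi.1 hj.1
  rw [hi.2, hj.2] at hE
  rw [← hE]
  exact h

end Table

/-! ### The pull counts along a run -/

lemma pulls_succ {K : ℕ} (a : ℕ → Fin K) (t : ℕ) (i : Fin K) :
    pulls a (t + 1) i = pulls a t i + if a t = i then 1 else 0 := by
  unfold pulls
  rw [Finset.range_add_one, Finset.filter_insert]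
  split_ifs with h
  · rw [Finset.card_insert_of_notMem (by simp)]
  · simp

lemma pulls_mono {K : ℕ} (a : ℕ → Fin K) (i : Fin K) : Monotone fun t => pulls a t i :=
  monotone_nat_of_le_succ fun t => by rw [pulls_succ]; exact Nat.le_add_right _ _

lemma sum_pulls {K : ℕ} (a : ℕ → Fin K) (t : ℕ) : ∑ i, pulls a t i = t := by
  have h := Finset.card_eq_sum_card_fiberwise (s := Finset.range t) (t := Finset.univ) (f := a)
    (by intro; simp)
  simpa [pulls] using h.symm

lemma pulls_le {K : ℕ} (a : ℕ → Fin K) (t : ℕ) (i : Fin K) : pulls a t i ≤ t := by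
  conv_rhs => rw [← sum_pulls a t]
  exact Finset.single_le_sum (f := fun i => pulls a t i) (fun _ _ => Nat.zero_le _)
    (Finset.mem_univ i)

lemma pulls_eq_add_card_Ico {K : ℕ} (a : ℕ → Fin K) {t t' : ℕ} (h : t ≤ t') (i : Fin K) :
    pulls a t' i = pulls a t i + ((Finset.Ico t t').filter fun s => a s = i).card := by
  unfold pulls
  rw [← Finset.card_union_of_disjoint, ← Finset.filter_union]
  · congr 2
    ext s
    simp
    omega
  · refine Finset.disjoint_filter_filter ?_
    rw [Finset.disjoint_left]
    intro s
    simp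
    omega

lemma regret_eq_sum_pulls {K L : ℕ} (P : Fin K → Fin L → ℝ) (b : Fin K) (a : ℕ → Fin K) (T : ℕ) :
    regret P b a T = ∑ i ∈ Finset.univ.erase b, gap P b i * pulls a T i := by
  have h0 : gap P b b * (pulls a T b : ℝ) = 0 := by simp [gap]
  rw [regret, ← zero_add (∑ i ∈ Finset.univ.erase b, _), ← h0,
    Finset.add_sum_erase _ (fun i => gap P b i * (pulls a T i : ℝ)) (Finset.mem_univ b)]
  have h := Finset.sum_fiberwise_of_maps_to (s := Finset.range T) (t := Finset.univ) (g := a)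
    (by simp) (fun t => gap P b (a t))
  rw [← h]
  refine Finset.sum_congr rfl fun i _ => ?_
  rw [Finset.sum_congr rfl (g := fun _ => gap P b i) fun t ht => by
    rw [(Finset.mem_filter.1 ht).2], Finset.sum_const, nsmul_eq_mul, mul_comm, pulls]

lemma feedbackCount_feedback {K L : ℕ} (x : Fin K → ℕ → Fin L) (a : ℕ → Fin K) (t : ℕ)
    (i : Fin K) (l : Fin L) :
    feedbackCount a (feedback x a) t i l =
      ((Finset.range (pulls a t i)).filter fun q => x i q = l).card := by
  induction t with
  | zero => simp [feedbackCount, pulls]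
  | succ t ih =>
    have hs : feedbackCount a (feedback x a) (t + 1) i l = feedbackCount a (feedback x a) t i l +
        if a t = i ∧ feedback x a t = l then 1 else 0 := by
      unfold feedbackCount
      rw [Finset.range_add_one, Finset.filter_insert]
      split_ifs with h
      · rw [Finset.card_insert_of_notMem (by simp)]
      · simp
    rw [hs, ih, pulls_succ]
    by_cases h : a t = i
    · subst h
      rw [if_pos rfl, Finset.range_add_one, Finset.filter_insert]
      by_cases hx : x (a t) (pulls a t (a t)) = l
      · rw [if_pos ⟨rfl, hx⟩, if_pos hx, Finset.card_insert_of_notMem (by simp)]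
      · rw [if_neg (by simpa [feedback] using hx), if_neg hx, add_zero]
    · simp [h]

lemma empirical_feedback {K L : ℕ} (x : Fin K → ℕ → Fin L) (a : ℕ → Fin K) (t : ℕ) (i : Fin K) :
    empirical a (feedback x a) t i = empDist fun q : Fin (pulls a t i) => x i q := by
  ext l
  rw [empirical, feedbackCount_feedback, empDist]
  congr 2
  rw [Finset.card_filter, Finset.card_filter,
    Fin.sum_univ_eq_sum_range (fun q => if x i q = l then 1 else 0)]

lemma ucb_feedback {K L : ℕ} (α : ℝ) (x : Fin K → ℕ → Fin L) (a : ℕ → Fin K) (t : ℕ) (i : Fin K) :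
    ucb α a (feedback x a) t i = empScore (pulls a t) x i + betaWidth α a t i := by
  rw [ucb]
  congr 1
  unfold empScore sampleScore
  congr 1
  ext j : 1
  exact empirical_feedback x a t j

lemma betaWidth_sub {K : ℕ} (hK : 2 ≤ K) (α : ℝ) (a : ℕ → Fin K) (t : ℕ) (i j : Fin K) :
    betaWidth α a t i - betaWidth α a t j =
      ((K : ℝ) - 2) / (K - 1) * (gammaWidth α a t i - gammaWidth α a t j) := by
  have hK' : (K : ℝ) - 1 ≠ 0 := by
    have : (2 : ℝ) ≤ K := by exact_mod_cast hK
    linarith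
  have h : ∀ i, ∑ k ∈ Finset.univ.erase i, gammaWidth α a t k =
      ∑ k, gammaWidth α a t k - gammaWidth α a t i := fun i => by
    rw [← Finset.add_sum_erase _ _ (Finset.mem_univ i)]; ring
  rw [betaWidth, betaWidth, h, h]
  field_simp
  ring

lemma leaderCount_self {K : ℕ} (i : Fin K) (n m : ℕ) : leaderCount i n m i = n := by
  simp [leaderCount]

lemma leaderCount_of_ne {K : ℕ} {i j : Fin K} (h : j ≠ i) (n m : ℕ) :
    leaderCount i n m j = m := by
  simp [leaderCount, h]

lemma leaderCount_diag {K : ℕ} (i : Fin K) (n : ℕ) : leaderCount i n n = fun _ => n := by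
  simp [leaderCount]

/-- One pass through the loop: either the chosen arm `u` becomes or stays the leader and gains a
pull, or all arms except the leader gain one. The first case includes the ties `m = n`, where any
arm may be named the leader. -/
lemma pulls_step {K : ℕ} {a : ℕ → Fin K} {t t' : ℕ} {ℓ u : Fin K} {n m : ℕ}
    (hmn : m ≤ n) (hpulls : pulls a t = leaderCount ℓ n m)
    (hstep : (u ∈ mostPulled a t ∧ a t = u ∧ t' = t + 1) ∨
      (u ∉ mostPulled a t ∧ Set.BijOn a (Set.Ico t t') (mostPulled a t)ᶜ)) :
    (pulls a t = leaderCount u n m ∧ pulls a t' = leaderCount u (n + 1) m ∧ t < t') ∨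
    (u ≠ ℓ ∧ m < n ∧ pulls a t' = leaderCount ℓ n (m + 1) ∧ t < t') := by
  have hpi : ∀ i, pulls a t i = leaderCount ℓ n m i := fun i => by rw [hpulls]
  have hmax : ∀ i, leaderCount ℓ n m i ≤ n := by
    intro i
    by_cases hi : i = ℓ
    · rw [hi, leaderCount_self]
    · rw [leaderCount_of_ne hi]; exact hmn
  have hℓ : ℓ ∈ mostPulled a t := fun j => by
    rw [hpi, hpi, leaderCount_self]; exact hmax j
  rcases hstep with ⟨hu, hat, rfl⟩ | ⟨hu, hbij⟩
  · left
    have hrep : leaderCount ℓ n m = leaderCount u n m := by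
      by_cases huℓ : u = ℓ
      · rw [huℓ]
      · have h1 := hu ℓ
        rw [hpi, hpi, leaderCount_self, leaderCount_of_ne huℓ] at h1
        obtain rfl : m = n := le_antisymm hmn h1
        rw [leaderCount_diag, leaderCount_diag]
    refine ⟨hpulls.trans hrep, ?_, Nat.lt_succ_self t⟩
    ext i
    rw [pulls_succ, hpi, hrep, hat]
    by_cases hi : i = u
    · subst hi; simp [leaderCount_self]
    · rw [if_neg (Ne.symm hi), leaderCount_of_ne hi, leaderCount_of_ne hi, add_zero]
  · right
    have huℓ : u ≠ ℓ := by rintro rfl; exact hu hℓ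
    have hlt : m < n := by
      refine lt_of_le_of_ne hmn ?_
      rintro rfl
      refine hu fun j => ?_
      rw [hpi, hpi, leaderCount_diag]
    have htt : t < t' := by
      obtain ⟨s, hs, -⟩ := hbij.surjOn (show u ∈ (mostPulled a t)ᶜ from hu)
      exact hs.1.trans_lt hs.2
    refine ⟨huℓ, hlt, ?_, htt⟩
    ext i
    rw [pulls_eq_add_card_Ico a htt.le, hpi]
    by_cases hi : i = ℓ
    · subst hi
      rw [leaderCount_self, leaderCount_self, Nat.add_eq_left, Finset.card_eq_zero,
        Finset.filter_eq_empty_iff]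
      intro s hs hsi
      have := hbij.mapsTo (show s ∈ Set.Ico t t' by simpa using hs)
      rw [hsi] at this
      exact this hℓ
    · rw [leaderCount_of_ne hi, leaderCount_of_ne hi, Nat.add_left_cancel_iff,
        Finset.card_eq_one]
      have hic : i ∈ (mostPulled a t)ᶜ := fun h => by
        have h1 := h ℓ
        rw [hpi, hpi, leaderCount_self, leaderCount_of_ne hi] at h1
        omega
      obtain ⟨s, hs, rfl⟩ := hbij.surjOn hic
      refine ⟨s, ?_⟩
      ext s'
      simp only [Finset.mem_filter, Finset.mem_Ico, Finset.mem_singleton]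
      constructor
      · rintro ⟨h1, h2⟩
        exact hbij.injOn h1 hs h2
      · rintro rfl
        exact ⟨hs, rfl⟩

/-- Counting along a run, with two kinds of exceptional steps. A step at leader count `n` in which
an arm other than `b` is pulled as leader must be paid for by `A n`; a step in which `b` leads, the
others have `m ≥ M` pulls each and `b` does not have the largest upper confidence bound must be paid
for by `B m`. While some arm other than `b` leads, the other arms catch up for free, since their
counts stay below the count of that leader. -/
theorem pulls_le_of_run {K L : ℕ} {α : ℝ} {τ : ℕ} {a : ℕ → Fin K} {r : ℕ → Fin L}
    (hrun : IsBordaUCBRun α τ a r) (b : Fin K) (T M : ℕ) {A B : ℕ → ℝ}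
    (hA0 : ∀ n, 0 ≤ A n) (hB0 : ∀ m, 0 ≤ B m)
    (hA : ∀ t ℓ n m, t < T → ℓ ≠ b → τ ≤ m → m ≤ n → pulls a t = leaderCount ℓ n m →
      (∀ i, ucb α a r t i ≤ ucb α a r t ℓ) → 1 ≤ A n)
    (hB : ∀ t u n m, t < T → u ≠ b → τ ≤ m → m < n → M ≤ m → pulls a t = leaderCount b n m →
      (∀ i, ucb α a r t i ≤ ucb α a r t u) → 1 ≤ B m)
    {i : Fin K} (hi : i ≠ b) :
    (pulls a T i : ℝ) ≤ τ + M + ∑ n ∈ Finset.range T, A n + ∑ m ∈ Finset.range T, B m := by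
  obtain ⟨hinit, σ, hσ0, hσ⟩ := hrun
  choose u hu hstep using hσ
  have hSA : ∀ n, 0 ≤ ∑ k ∈ Finset.range n, A k := fun n =>
    Finset.sum_nonneg fun k _ => hA0 k
  have hSB : ∀ n, 0 ≤ ∑ k ∈ Finset.range n, B k := fun n =>
    Finset.sum_nonneg fun k _ => hB0 k
  have hmonoA : ∀ {n n'}, n ≤ n' → ∑ k ∈ Finset.range n, A k ≤ ∑ k ∈ Finset.range n', A k :=
    fun h => Finset.sum_le_sum_of_subset_of_nonneg (Finset.range_mono h) fun k _ _ => hA0 k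
  have hmonoB : ∀ {n n'}, n ≤ n' → ∑ k ∈ Finset.range n, B k ≤ ∑ k ∈ Finset.range n', B k :=
    fun h => Finset.sum_le_sum_of_subset_of_nonneg (Finset.range_mono h) fun k _ _ => hB0 k
  -- Every arm but one has the same number of pulls whenever the loop is entered.
  have hstate : ∀ s, s ≤ σ s ∧ ∃ ℓ n m, τ ≤ m ∧ m ≤ n ∧ pulls a (σ s) = leaderCount ℓ n m := by
    intro s
    induction s with
    | zero =>
      refine ⟨Nat.zero_le _, b, τ, τ, le_rfl, le_rfl, ?_⟩
      rw [hσ0, leaderCount_diag]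
      ext i
      exact hinit i
    | succ s ih =>
      obtain ⟨hs, ℓ, n, m, hτm, hmn, hp⟩ := ih
      rcases pulls_step hmn hp (hstep s) with ⟨-, h, hlt⟩ | ⟨-, hlt', h, hlt⟩
      · exact ⟨by omega, _, _, _, hτm, by omega, h⟩
      · exact ⟨by omega, _, _, _, by omega, by omega, h⟩
  -- At a tie all counts agree, so that it does not matter which arm is called the leader.
  have hclaim : ∀ s, (∀ s' < s, σ s' < T) → ∃ ℓ n m, τ ≤ m ∧ m ≤ n ∧ n ≤ max T τ ∧
      pulls a (σ s) = leaderCount ℓ n m ∧ ∀ i, i ≠ b → (leaderCount ℓ n m i : ℝ) ≤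
        τ + M + ∑ k ∈ Finset.range n, A k + ∑ k ∈ Finset.range m, B k := by
    intro s
    induction s with
    | zero =>
      intro _
      refine ⟨b, τ, τ, le_rfl, le_rfl, le_max_right _ _, ?_, fun i hi => ?_⟩
      · rw [hσ0, leaderCount_diag]
        ext i
        exact hinit i
      · rw [leaderCount_diag]
        have := hSA τ
        have := hSB τ
        have : (0 : ℝ) ≤ M := Nat.cast_nonneg M
        linarith
    | succ s ih =>
      intro hlt
      obtain ⟨ℓ, n, m, hτm, hmn, hnT, hp, hbd⟩ := ih fun s' hs' => hlt s' (by omega)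
      have hsT : σ s < T := hlt s (Nat.lt_succ_self s)
      have hn : n ≤ σ s := by
        have := pulls_le a (σ s) ℓ
        rwa [hp, leaderCount_self] at this
      rcases pulls_step hmn hp (hstep s) with ⟨hp', h, -⟩ | ⟨huℓ, hlt', h, -⟩
      · refine ⟨u s, n + 1, m, hτm, by omega, le_max_of_le_left (by omega), h, fun i hi => ?_⟩
        have hbi := hbd i hi
        rw [← hp, hp'] at hbi
        have hAn := hA0 n
        rw [Finset.sum_range_succ]
        by_cases hiu : i = u s
        · have h1 := hA (σ s) (u s) n m hsT (hiu ▸ hi) hτm hmn hp' (hu s)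
          rw [hiu, leaderCount_self] at hbi ⊢
          push_cast
          linarith
        · rw [leaderCount_of_ne hiu] at hbi ⊢
          linarith
      · refine ⟨ℓ, n, m + 1, by omega, by omega, hnT, h, fun i hi => ?_⟩
        have hbi := hbd i hi
        have hBm := hB0 m
        rw [Finset.sum_range_succ]
        by_cases hiℓ : i = ℓ
        · rw [hiℓ, leaderCount_self] at hbi ⊢
          linarith
        · rw [leaderCount_of_ne hiℓ] at hbi ⊢
          by_cases hℓb : ℓ = b
          · by_cases hMm : M ≤ m
            · subst hℓb
              have h1 := hB (σ s) (u s) n m hsT huℓ hτm hlt' hMm hp (hu s)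
              push_cast
              linarith
            · have : ((m + 1 : ℕ) : ℝ) ≤ M := by exact_mod_cast (by omega : m + 1 ≤ M)
              have := hSA n
              have := hSB m
              have : (0 : ℝ) ≤ τ := Nat.cast_nonneg τ
              linarith
          · -- The leader is not `b`, and the followers have not overtaken it.
            have hbℓ := hbd ℓ hℓb
            rw [leaderCount_self] at hbℓ
            have : ((m + 1 : ℕ) : ℝ) ≤ n := by exact_mod_cast hlt'
            linarith
  by_cases hT : T ≤ K * τ
  · have h := pulls_mono a i hT
    simp only [hinit] at h
    have : (pulls a T i : ℝ) ≤ τ := by exact_mod_cast h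
    have := hSA T
    have := hSB T
    have : (0 : ℝ) ≤ M := Nat.cast_nonneg M
    linarith
  · have hex : ∃ s, T ≤ σ s := ⟨T, (hstate T).1⟩
    classical
    obtain ⟨ℓ, n, m, -, hmn, hnT, hp, hbd⟩ := hclaim (Nat.find hex) fun s' hs' =>
      not_le.1 (Nat.find_min hex hs')
    have hτT : τ ≤ T := by
      have : 1 * τ ≤ K * τ := Nat.mul_le_mul_right τ (by have := i.isLt; omega)
      omega
    rw [max_eq_left hτT] at hnT
    have h1 : (pulls a T i : ℝ) ≤ leaderCount ℓ n m i := by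
      rw [← hp]
      exact_mod_cast pulls_mono a i (Nat.find_spec hex)
    have := hbd i hi
    have := hmonoA hnT
    have := hmonoB (hmn.trans hnT)
    linarith

/-! ### Numerical bounds on the parameter and the variance proxy -/

/-- The only property of the parameter that is used. It holds with the same constant for all `ε'`,
as `(1 + 3ε')² ≥ (1 - ε')²`. -/
lemma three_halves_le_mul_bordaAlpha {K : ℕ} (hK : 3 ≤ K) {ε' : ℝ} (hε : 0 < ε') (hε1 : ε' ≠ 1) :
    3 / 2 ≤ (((K : ℝ) - 2) / (K - 1)) ^ 2 * bordaAlpha K ε' := by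
  have hK' : (3 : ℝ) ≤ K := by exact_mod_cast hK
  have h1 : (0 : ℝ) < K - 1 := by linarith
  have h2 : (0 : ℝ) < K - 2 := by linarith
  have h3 : 0 < (1 - ε') ^ 2 := by
    have : 1 - ε' ≠ 0 := sub_ne_zero.2 hε1.symm
    positivity
  have h4 : 3 / 2 ≤ 3 * (1 + 3 * ε') ^ 2 / (2 * (1 - ε') ^ 2) := by
    rw [div_le_div_iff₀ (by norm_num) (by positivity)]
    nlinarith
  refine le_trans ?_ (mul_le_mul_of_nonneg_left (le_max_right _ _) (by positivity))
  have h5 : (((K : ℝ) - 2) / (K - 1)) ^ 2 * (3 * (1 + 3 * ε') ^ 2 / (2 * (1 - ε') ^ 2) *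
      (((K : ℝ) - 1) / (K - 2)) ^ 2) = 3 * (1 + 3 * ε') ^ 2 / (2 * (1 - ε') ^ 2) := by
    field_simp
  rw [h5]
  exact h4

lemma nonneg_of_three_halves_le {c α : ℝ} (hα : 3 / 2 ≤ c ^ 2 * α) : 0 ≤ α := by
  by_contra hneg
  have := mul_nonpos_of_nonneg_of_nonpos (sq_nonneg c) (not_le.1 hneg).le
  linarith

lemma leader_sensitivity_le {K : ℕ} (hK : 3 ≤ K) : ((K : ℝ) / (K - 1)) ^ 2 ≤ 9 / 4 := by
  have hK' : (3 : ℝ) ≤ K := by exact_mod_cast hK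
  have h1 : (0 : ℝ) < K - 1 := by linarith
  rw [div_pow, div_le_div_iff₀ (by positivity) (by norm_num)]
  nlinarith

lemma follower_sensitivity_le {K : ℕ} (hK : 3 ≤ K) : ((K : ℝ) + 2) / (K - 1) ≤ 5 / 2 := by
  have hK' : (3 : ℝ) ≤ K := by exact_mod_cast hK
  rw [div_le_div_iff₀ (by linarith) (by norm_num)]
  linarith

/-- For `m` samples of every arm, the sum of squares in McDiarmid's inequality is at most
`2α / m`. -/
lemma total_sensitivity_le_two_mul {K : ℕ} (hK : 3 ≤ K) {α : ℝ}
    (hα : 3 / 2 ≤ (((K : ℝ) - 2) / (K - 1)) ^ 2 * α) :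
    ((K : ℝ) / (K - 1)) ^ 2 + (K + 2) / (K - 1) ≤ 2 * α := by
  have hK' : (3 : ℝ) ≤ K := by exact_mod_cast hK
  have h1 : (0 : ℝ) < K - 1 := by linarith
  have h2 : (0 : ℝ) < K - 2 := by linarith
  have h3 : 3 * (((K : ℝ) - 1) / (K - 2)) ^ 2 ≤ 2 * α := by
    have h := mul_le_mul_of_nonneg_left hα (sq_nonneg (((K : ℝ) - 1) / (K - 2)))
    have h' : (((K : ℝ) - 1) / (K - 2)) ^ 2 * ((((K : ℝ) - 2) / (K - 1)) ^ 2 * α) = α := by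
      field_simp
    rw [h'] at h
    linarith
  refine le_trans ?_ h3
  have h4 : ((K : ℝ) / (K - 1)) ^ 2 + (K + 2) / (K - 1) =
      (2 * (K : ℝ) ^ 2 + K - 2) / (K - 1) ^ 2 := by
    field_simp; ring
  rw [h4, div_pow, ← mul_div_assoc, div_le_div_iff₀ (by positivity) (by positivity)]
  obtain ⟨y, hy, hKy⟩ : ∃ y : ℝ, 0 ≤ y ∧ (K : ℝ) = y + 3 := ⟨K - 3, by linarith, by ring⟩
  rw [hKy]
  ring_nf
  nlinarith [mul_nonneg hy hy, mul_nonneg (mul_nonneg hy hy) hy,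
    mul_nonneg (mul_nonneg hy hy) (mul_nonneg hy hy)]

/-! ### The two kinds of estimation errors -/

/-- A lower bound, independent of `α` and of the round, for the excess of the confidence width of a
follower with `m` pulls over that of a leader with `n` pulls. The factor `3 / 2` is the lower bound
for `((K - 2) / (K - 1))² α`, and `log n` bounds the logarithm of the current round from below. -/
def leaderMargin (n m : ℕ) : ℝ :=
  Real.sqrt (3 / 2 * Real.log n) * (1 / Real.sqrt m - 1 / Real.sqrt n)

lemma leaderMargin_nonneg {n m : ℕ} (hm : m ≠ 0) (hmn : m ≤ n) : 0 ≤ leaderMargin n m := by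
  have hm' : (0 : ℝ) < m := Nat.cast_pos.2 (Nat.pos_of_ne_zero hm)
  refine mul_nonneg (Real.sqrt_nonneg _) (sub_nonneg.2 ?_)
  exact one_div_le_one_div_of_le (Real.sqrt_pos.2 hm') (Real.sqrt_le_sqrt (by exact_mod_cast hmn))

/-- The constants `400` and `27 / 20 < 3 / 2` are chosen so that in `measureReal_leaderError_le` the
exponent of `n` stays below `-1`. -/
lemma log_le_mul_leaderMargin_sq {n m : ℕ} (hm : m ≠ 0) (hmn : 400 * m ≤ n) :
    27 / 20 * Real.log n ≤ m * leaderMargin n m ^ 2 := by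
  have hm' : (0 : ℝ) < m := Nat.cast_pos.2 (Nat.pos_of_ne_zero hm)
  have hmn' : 400 * (m : ℝ) ≤ n := by exact_mod_cast hmn
  have hlog : 0 ≤ Real.log n := Real.log_natCast_nonneg n
  have hsm : 0 < Real.sqrt m := Real.sqrt_pos.2 hm'
  have hsn : 20 * Real.sqrt m ≤ Real.sqrt n := by
    refine Real.le_sqrt_of_sq_le ?_
    rw [mul_pow, Real.sq_sqrt hm'.le]
    linarith
  have h1 : 1 / Real.sqrt n ≤ 1 / (20 * Real.sqrt m) :=
    one_div_le_one_div_of_le (by positivity) hsn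
  have h2 : 19 / 20 * (1 / Real.sqrt m) ≤ 1 / Real.sqrt m - 1 / Real.sqrt n := by
    have : 1 / (20 * Real.sqrt m) = 1 / 20 * (1 / Real.sqrt m) := by field_simp
    linarith
  have h3 : (19 / 20 * (1 / Real.sqrt m)) ^ 2 ≤ (1 / Real.sqrt m - 1 / Real.sqrt n) ^ 2 :=
    pow_le_pow_left₀ (by positivity) h2 2
  have h4 : (19 / 20 * (1 / Real.sqrt m)) ^ 2 = 361 / 400 / m := by
    rw [mul_pow, one_div_pow, Real.sq_sqrt hm'.le]; ring
  rw [leaderMargin, mul_pow, Real.sq_sqrt (by positivity)]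
  have h5 : 361 / 400 ≤ m * (1 / Real.sqrt m - 1 / Real.sqrt n) ^ 2 := by
    rw [h4, div_le_iff₀ hm'] at h3
    linarith
  nlinarith

/-- The tables of feedback for which arm `ℓ`, being the leader with `n` pulls against `m` pulls of
the others, has so large an estimated score that its upper confidence bound can reach that of
`b`. -/
def leaderError {K L : ℕ} (b ℓ : Fin K) (n m : ℕ) : Set (Fin K → ℕ → Fin L) :=
  {x | leaderMargin n m ≤ empScore (leaderCount ℓ n m) x ℓ - empScore (leaderCount ℓ n m) x b}

/-- The tables of feedback for which arm `i` with `m` pulls has an estimated score at most `d / 2`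
below that of the leader `b` with `n` pulls. For the gap `d` of arm `i` this is a deviation of at
least `d / 2`. -/
def challengerError {K L : ℕ} (b i : Fin K) (d : ℝ) (n m : ℕ) : Set (Fin K → ℕ → Fin L) :=
  {x | -(d / 2) ≤ empScore (leaderCount b n m) x i - empScore (leaderCount b n m) x b}

section Run

variable {K L : ℕ} {α : ℝ} {x : Fin K → ℕ → Fin L} {a : ℕ → Fin K} {t : ℕ} {n m : ℕ}

lemma ucb_sub_ucb_of_leaderCount (hK : 2 ≤ K) {ℓ : Fin K}
    (hp : pulls a t = leaderCount ℓ n m) {i : Fin K} (hi : i ≠ ℓ) :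
    ucb α a (feedback x a) t i - ucb α a (feedback x a) t ℓ =
      empScore (leaderCount ℓ n m) x i - empScore (leaderCount ℓ n m) x ℓ +
      ((K : ℝ) - 2) / (K - 1) * (Real.sqrt (α * Real.log ((t : ℝ) + 1) / m) -
        Real.sqrt (α * Real.log ((t : ℝ) + 1) / n)) := by
  have h := betaWidth_sub hK α a t i ℓ
  rw [gammaWidth, gammaWidth, hp, leaderCount_self, leaderCount_of_ne hi] at h
  rw [ucb_feedback, ucb_feedback, hp, ← h]
  ring

lemma mem_leaderError_of_ucb_le (hK : 3 ≤ K)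
    (hα : 3 / 2 ≤ (((K : ℝ) - 2) / (K - 1)) ^ 2 * α) {b ℓ : Fin K} (hb : b ≠ ℓ)
    (hm : m ≠ 0) (hmn : m ≤ n) (hp : pulls a t = leaderCount ℓ n m)
    (h : ucb α a (feedback x a) t b ≤ ucb α a (feedback x a) t ℓ) :
    x ∈ leaderError b ℓ n m := by
  have hK' : (3 : ℝ) ≤ K := by exact_mod_cast hK
  have hdiff := ucb_sub_ucb_of_leaderCount (α := α) (x := x) (by omega) hp hb
  have hm' : (0 : ℝ) < m := Nat.cast_pos.2 (Nat.pos_of_ne_zero hm)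
  have hmn' : (m : ℝ) ≤ n := by exact_mod_cast hmn
  have hn' : (0 : ℝ) < n := hm'.trans_le hmn'
  have hκ : 0 ≤ ((K : ℝ) - 2) / (K - 1) := div_nonneg (by linarith) (by linarith)
  have hnt : (n : ℝ) ≤ t + 1 := by
    have h1 := pulls_le a t ℓ
    rw [hp, leaderCount_self] at h1
    exact_mod_cast h1.trans (Nat.le_succ t)
  have hα0 : 0 ≤ α := nonneg_of_three_halves_le hα
  have hlog0 : 0 ≤ Real.log n := Real.log_natCast_nonneg n
  have hlog : Real.log n ≤ Real.log ((t : ℝ) + 1) := Real.log_le_log hn' hnt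
  have hinv : 0 ≤ 1 / Real.sqrt m - 1 / Real.sqrt n :=
    sub_nonneg.2 (one_div_le_one_div_of_le (Real.sqrt_pos.2 hm') (Real.sqrt_le_sqrt hmn'))
  have hsqrt : Real.sqrt (3 / 2 * Real.log n) ≤
      ((K : ℝ) - 2) / (K - 1) * Real.sqrt (α * Real.log ((t : ℝ) + 1)) := by
    refine Real.sqrt_le_iff.2 ⟨by positivity, ?_⟩
    rw [mul_pow, Real.sq_sqrt (mul_nonneg hα0 (hlog0.trans hlog)), ← mul_assoc]
    exact mul_le_mul hα hlog hlog0 (by positivity)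
  have hmargin : leaderMargin n m ≤ ((K : ℝ) - 2) / (K - 1) *
      (Real.sqrt (α * Real.log ((t : ℝ) + 1) / m) -
        Real.sqrt (α * Real.log ((t : ℝ) + 1) / n)) := by
    refine (mul_le_mul_of_nonneg_right hsqrt hinv).trans (le_of_eq ?_)
    rw [Real.sqrt_div' _ hm'.le, Real.sqrt_div' _ hn'.le]
    ring
  change leaderMargin n m ≤ _
  linarith

lemma mem_challengerError_of_ucb_le (hK : 3 ≤ K) (hα : 0 ≤ α) {b i : Fin K} (hi : i ≠ b)
    {d δ : ℝ} (hδ : 0 < δ) (hδd : δ ≤ d) {T : ℕ} (htT : t < T) (hm : m ≠ 0)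
    (hM : 4 * α / δ ^ 2 * Real.log T ≤ m) (hp : pulls a t = leaderCount b n m)
    (h : ucb α a (feedback x a) t b ≤ ucb α a (feedback x a) t i) :
    x ∈ challengerError b i d n m := by
  have hK' : (3 : ℝ) ≤ K := by exact_mod_cast hK
  have hdiff := ucb_sub_ucb_of_leaderCount (α := α) (x := x) (by omega) hp hi
  have hm' : (0 : ℝ) < m := Nat.cast_pos.2 (Nat.pos_of_ne_zero hm)
  have hκ0 : 0 ≤ ((K : ℝ) - 2) / (K - 1) := div_nonneg (by linarith) (by linarith)
  have hκ1 : ((K : ℝ) - 2) / (K - 1) ≤ 1 := (div_le_one (by linarith)).2 (by linarith)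
  have hlog : Real.log ((t : ℝ) + 1) ≤ Real.log T :=
    Real.log_le_log (by positivity) (by exact_mod_cast htT)
  have hγ : Real.sqrt (α * Real.log ((t : ℝ) + 1) / m) ≤ δ / 2 := by
    refine Real.sqrt_le_iff.2 ⟨by positivity, ?_⟩
    rw [div_le_iff₀ hm']
    rw [div_mul_eq_mul_div, div_le_iff₀ (by positivity)] at hM
    nlinarith [mul_le_mul_of_nonneg_left hlog hα]
  have h1 : ((K : ℝ) - 2) / (K - 1) * (Real.sqrt (α * Real.log ((t : ℝ) + 1) / m) -
      Real.sqrt (α * Real.log ((t : ℝ) + 1) / n)) ≤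
      Real.sqrt (α * Real.log ((t : ℝ) + 1) / m) := by
    refine (mul_le_mul_of_nonneg_left (sub_le_self _ (Real.sqrt_nonneg _)) hκ0).trans ?_
    exact mul_le_of_le_one_left (Real.sqrt_nonneg _) hκ1
  change -(d / 2) ≤ _
  linarith

end Run

section Table

variable {K L : ℕ} {Ω : Type*} [MeasurableSpace Ω] {Pr : Measure Ω} [IsProbabilityMeasure Pr]
  {P : Fin K → Fin L → ℝ} {X : Fin K → ℕ → Ω → Fin L}

lemma measurableSet_leaderError (hX : ∀ i m, Measurable (X i m)) (b ℓ : Fin K) (n m : ℕ) :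
    MeasurableSet {ω | (fun i q => X i q ω) ∈ leaderError b ℓ n m} :=
  measurableSet_le measurable_const
    ((measurable_empScore_comp hX _ _).sub (measurable_empScore_comp hX _ _))

lemma measurableSet_challengerError (hX : ∀ i m, Measurable (X i m)) (b i : Fin K) (d : ℝ)
    (n m : ℕ) : MeasurableSet {ω | (fun i q => X i q ω) ∈ challengerError b i d n m} :=
  measurableSet_le measurable_const
    ((measurable_empScore_comp hX _ _).sub (measurable_empScore_comp hX _ _))

/-- If the counts are comparable, `n < 400 m`, the gap alone makes the error exponentially unlikely
in `n`. Otherwise the leader's estimate is almost exact and the followers' widths exceed the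
leader's by nearly `√(α log n / m)`, which yields a summable power of `n`. -/
lemma measureReal_leaderError_le (hK : 3 ≤ K) (hX : ∀ i m, Measurable (X i m))
    (hind : iIndepFun (fun p : Fin K × ℕ => X p.1 p.2) Pr)
    (hP : ∀ i m l, Pr.real {ω | X i m ω = l} = P i l) {b ℓ : Fin K} (hℓ : ℓ ≠ b)
    (hd : 0 ≤ gap P b ℓ) {n m : ℕ} (hm : m ≠ 0) (hmn : m ≤ n) :
    Pr.real {ω | (fun i q => X i q ω) ∈ leaderError b ℓ n m} ≤
      Real.exp (-(gap P b ℓ ^ 2 / 950 * n)) +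
        (n : ℝ) ^ (-(51 / 50) : ℝ) * Real.exp (-(gap P b ℓ ^ 2 / 2 * m)) := by
  set d := gap P b ℓ with hd_def
  have hm' : (0 : ℝ) < m := Nat.cast_pos.2 (Nat.pos_of_ne_zero hm)
  have hmn' : (m : ℝ) ≤ n := by exact_mod_cast hmn
  have hn' : (0 : ℝ) < n := hm'.trans_le hmn'
  have hw := leaderMargin_nonneg hm hmn
  have htail : ∀ V : ℝ, ((K : ℝ) / (K - 1)) ^ 2 / n + ((K : ℝ) + 2) / (K - 1) / m ≤ V →
      Pr.real {ω | (fun i q => X i q ω) ∈ leaderError b ℓ n m} ≤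
        Real.exp (-(2 * (d + leaderMargin n m) ^ 2 / V)) := by
    intro V hV
    refine le_trans (le_of_eq ?_) (measureReal_empScore_sub_ge_le (l := ℓ) (by omega) hX hind hP
      hℓ (Or.inl rfl) (n := n) (by omega) hm (add_nonneg hd hw) hV)
    congr 1
    ext ω
    have : bordaScore P ℓ - bordaScore P b + (d + leaderMargin n m) = leaderMargin n m := by
      rw [hd_def, gap]; ring
    simp only [leaderError, Set.mem_ofPred_eq, this]
  have hs1 := leader_sensitivity_le hK
  have hs2 := follower_sensitivity_le hK
  have hs2m : ((K : ℝ) + 2) / (K - 1) / m ≤ 5 / 2 / m := by gcongr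
  rcases lt_or_ge n (400 * m) with hlt | hge
  · have hlt' : (n : ℝ) ≤ 400 * m := by exact_mod_cast hlt.le
    refine (htail (19 / 4 / m) ?_).trans (le_add_of_le_of_nonneg ?_ (by positivity))
    · have h1 : ((K : ℝ) / (K - 1)) ^ 2 / n ≤ 9 / 4 / m := by gcongr
      have h2 : (19 : ℝ) / 4 / m = 9 / 4 / m + 5 / 2 / m := by ring
      linarith
    · refine Real.exp_le_exp.2 (neg_le_neg ?_)
      rw [div_div_eq_mul_div, le_div_iff₀ (by norm_num)]
      have h1 : d ^ 2 ≤ (d + leaderMargin n m) ^ 2 := pow_le_pow_left₀ hd (by linarith) 2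
      nlinarith [mul_le_mul_of_nonneg_right h1 hm'.le, mul_le_mul_of_nonneg_left hlt' (sq_nonneg d)]
  · have hge' : 400 * (m : ℝ) ≤ n := by exact_mod_cast hge
    refine (htail (13 / 5 / m) ?_).trans (le_add_of_nonneg_of_le (Real.exp_pos _).le ?_)
    · have h1 : ((K : ℝ) / (K - 1)) ^ 2 / n ≤ 9 / 4 / (400 * m) := by gcongr
      have h2 : (9 : ℝ) / 4 / (400 * m) = 9 / 1600 / m := by field_simp; norm_num
      have h3 : (13 : ℝ) / 5 / m = 1 / 10 / m + 5 / 2 / m := by ring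
      have h4 : (9 : ℝ) / 1600 / m ≤ 1 / 10 / m :=
        div_le_div_of_nonneg_right (by norm_num) hm'.le
      linarith
    · rw [Real.rpow_def_of_pos hn', ← Real.exp_add]
      refine Real.exp_le_exp.2 ?_
      have hlog := log_le_mul_leaderMargin_sq hm hge
      have hlog0 : 0 ≤ Real.log n := Real.log_natCast_nonneg n
      have h1 : d ^ 2 + leaderMargin n m ^ 2 ≤ (d + leaderMargin n m) ^ 2 := by
        nlinarith [mul_nonneg hd hw]
      have h2 : 2 * (d + leaderMargin n m) ^ 2 / (13 / 5 / m) =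
          10 / 13 * (m * (d + leaderMargin n m) ^ 2) := by field_simp; ring
      rw [h2]
      have h3 := mul_le_mul_of_nonneg_left h1 hm'.le
      have h4 := mul_nonneg hm'.le (sq_nonneg d)
      linarith

/-- The first `M` pulls pay for the factor `T⁻¹`, which compensates the union over the counts `n` of
the leader; the further `j` pulls give the exponential decay. -/
lemma measureReal_challengerError_le (hK : 3 ≤ K) (hX : ∀ i m, Measurable (X i m))
    (hind : iIndepFun (fun p : Fin K × ℕ => X p.1 p.2) Pr)
    (hP : ∀ i m l, Pr.real {ω | X i m ω = l} = P i l) {b i : Fin K} (hi : i ≠ b)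
    {α : ℝ} (hα : 3 / 2 ≤ (((K : ℝ) - 2) / (K - 1)) ^ 2 * α)
    {δ : ℝ} (hδ : 0 < δ) (hδd : δ ≤ gap P b i) {T M : ℕ} (hT : T ≠ 0)
    (hM : 4 * α / δ ^ 2 * Real.log T ≤ M) {n j : ℕ} (hm : M + j ≠ 0) (hmn : M + j ≤ n) :
    Pr.real {ω | (fun i q => X i q ω) ∈ challengerError b i (gap P b i) n (M + j)} ≤
      (T : ℝ)⁻¹ * Real.exp (-(gap P b i ^ 2 / 10 * j)) := by
  set d := gap P b i with hd_def
  have hd : 0 < d := hδ.trans_le hδd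
  have hm' : (0 : ℝ) < (M + j : ℕ) := Nat.cast_pos.2 (Nat.pos_of_ne_zero hm)
  have hmn' : ((M + j : ℕ) : ℝ) ≤ n := by exact_mod_cast hmn
  have hT' : (0 : ℝ) < T := Nat.cast_pos.2 (Nat.pos_of_ne_zero hT)
  have hlogT : 0 ≤ Real.log T := Real.log_natCast_nonneg T
  set v := ((K : ℝ) / (K - 1)) ^ 2 + (K + 2) / (K - 1) with hv
  have hv1 : v ≤ 2 * α := total_sensitivity_le_two_mul hK hα
  have hv2 : v ≤ 5 := by
    have := leader_sensitivity_le hK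
    have := follower_sensitivity_le hK
    linarith
  have hv0 : 0 < v := by
    have hK' : (3 : ℝ) ≤ K := by exact_mod_cast hK
    have : (0 : ℝ) < K - 1 := by linarith
    positivity
  have htail := measureReal_empScore_sub_ge_le (l := b) (n := n) (m := M + j) (by omega) hX hind
      hP hi (Or.inr rfl) (by omega) hm (u := d / 2) (V := v / (M + j : ℕ)) (by positivity)
      (by
        have h1 : ((K : ℝ) / (K - 1)) ^ 2 / n ≤ ((K : ℝ) / (K - 1)) ^ 2 / (M + j : ℕ) := by
          gcongr
        rw [hv, add_div _ _ ((M + j : ℕ) : ℝ)]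
        exact add_le_add_left h1 _)
  refine le_trans (le_of_eq ?_) (htail.trans ?_)
  · congr 1
    ext ω
    have : bordaScore P i - bordaScore P b + d / 2 = -(d / 2) := by
      rw [hd_def, gap]; ring
    simp only [challengerError, Set.mem_ofPred_eq, this]
  · have hTinv : (T : ℝ)⁻¹ = Real.exp (-Real.log T) := by rw [Real.exp_neg, Real.exp_log hT']
    rw [hTinv, ← Real.exp_add]
    refine Real.exp_le_exp.2 ?_
    have h2 : 2 * (d / 2) ^ 2 / (v / (M + j : ℕ)) = d ^ 2 * (M + j) / (2 * v) := by
      push_cast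
      field_simp
    rw [h2, ← neg_add, neg_le_neg_iff, le_div_iff₀ (by positivity)]
    have h3 : 4 * α * Real.log T ≤ M * d ^ 2 := by
      rw [div_mul_eq_mul_div, div_le_iff₀ (by positivity)] at hM
      refine hM.trans ?_
      gcongr
    have h4 : Real.log T * v ≤ Real.log T * (2 * α) := mul_le_mul_of_nonneg_left hv1 hlogT
    have h5 : d ^ 2 * j * v ≤ d ^ 2 * j * 5 := mul_le_mul_of_nonneg_left hv2 (by positivity)
    linarith

end Table

/-! ### Summing the error probabilities -/

/-- A bound for the expected number of estimation errors caused by an arm with gap `d`: the first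
two summands bound the leader errors, the third one the challenger errors. For `d = 0` the series of
exponentials diverge and have the junk value zero; this is harmless, as only nonnegativity is used
for the Borda winner. -/
def errorBound (d : ℝ) : ℝ :=
  (∑' n : ℕ, (n : ℝ) * Real.exp (-(d ^ 2 / 950 * n))) +
    (∑' n : ℕ, (n : ℝ) ^ (-(51 / 50) : ℝ)) * (∑' m : ℕ, Real.exp (-(d ^ 2 / 2 * m))) +
    ∑' j : ℕ, Real.exp (-(d ^ 2 / 10 * j))

lemma errorBound_nonneg (d : ℝ) : 0 ≤ errorBound d := by
  have h1 : 0 ≤ ∑' n : ℕ, (n : ℝ) * Real.exp (-(d ^ 2 / 950 * n)) :=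
    tsum_nonneg fun n => by positivity
  have h2 : 0 ≤ ∑' n : ℕ, (n : ℝ) ^ (-(51 / 50) : ℝ) := tsum_nonneg fun n => by positivity
  have h3 : 0 ≤ ∑' m : ℕ, Real.exp (-(d ^ 2 / 2 * m)) := tsum_nonneg fun n => by positivity
  have h4 : 0 ≤ ∑' j : ℕ, Real.exp (-(d ^ 2 / 10 * j)) := tsum_nonneg fun n => by positivity
  exact add_nonneg (add_nonneg h1 (mul_nonneg h2 h3)) h4

lemma summable_exp_neg_mul_natCast {c : ℝ} (hc : 0 < c) :
    Summable fun n : ℕ => Real.exp (-(c * n)) := by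
  simpa [neg_mul] using Real.summable_pow_mul_exp_neg_nat_mul 0 hc

lemma sum_leaderError_le {d : ℝ} (hd : 0 < d) (T : ℕ) :
    ∑ n ∈ Finset.range T, ∑ m ∈ Finset.Icc 1 n, (Real.exp (-(d ^ 2 / 950 * n)) +
        (n : ℝ) ^ (-(51 / 50) : ℝ) * Real.exp (-(d ^ 2 / 2 * m))) ≤
      (∑' n : ℕ, (n : ℝ) * Real.exp (-(d ^ 2 / 950 * n))) +
      (∑' n : ℕ, (n : ℝ) ^ (-(51 / 50) : ℝ)) * (∑' m : ℕ, Real.exp (-(d ^ 2 / 2 * m))) := by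
  have hs1 : Summable fun n : ℕ => (n : ℝ) * Real.exp (-(d ^ 2 / 950 * n)) := by
    simpa [neg_mul] using Real.summable_pow_mul_exp_neg_nat_mul 1 (r := d ^ 2 / 950) (by positivity)
  have hs2 : Summable fun n : ℕ => (n : ℝ) ^ (-(51 / 50) : ℝ) :=
    Real.summable_nat_rpow.2 (by norm_num)
  have hs3 := summable_exp_neg_mul_natCast (c := d ^ 2 / 2) (by positivity)
  simp only [Finset.sum_add_distrib, Finset.sum_const, Nat.card_Icc, Nat.add_sub_cancel,
    nsmul_eq_mul, ← Finset.mul_sum]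
  refine add_le_add (hs1.sum_le_tsum _ fun n _ => by positivity) ?_
  calc ∑ n ∈ Finset.range T, (n : ℝ) ^ (-(51 / 50) : ℝ) *
        ∑ m ∈ Finset.Icc 1 n, Real.exp (-(d ^ 2 / 2 * m))
      ≤ ∑ n ∈ Finset.range T, (n : ℝ) ^ (-(51 / 50) : ℝ) *
        ∑' m : ℕ, Real.exp (-(d ^ 2 / 2 * m)) :=
        Finset.sum_le_sum fun n _ => mul_le_mul_of_nonneg_left
          (hs3.sum_le_tsum _ fun m _ => by positivity) (by positivity)
    _ ≤ _ := by
        rw [← Finset.sum_mul]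
        exact mul_le_mul_of_nonneg_right (hs2.sum_le_tsum _ fun n _ => by positivity)
          (tsum_nonneg fun m => by positivity)

lemma sum_challengerError_le {d : ℝ} (hd : 0 < d) {T : ℕ} (hT : T ≠ 0) :
    ∑ j ∈ Finset.range T, ∑ _n ∈ Finset.range T,
        (T : ℝ)⁻¹ * Real.exp (-(d ^ 2 / 10 * j)) ≤
      ∑' j : ℕ, Real.exp (-(d ^ 2 / 10 * j)) := by
  have hs := summable_exp_neg_mul_natCast (c := d ^ 2 / 10) (by positivity)
  have hT' : (T : ℝ) ≠ 0 := Nat.cast_ne_zero.2 hT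
  simp only [Finset.sum_const, Finset.card_range, nsmul_eq_mul, mul_inv_cancel_left₀ hT']
  exact hs.sum_le_tsum _ fun j _ => by positivity

section Table

variable {K L : ℕ} {Ω : Type*} [MeasurableSpace Ω] {Pr : Measure Ω} [IsProbabilityMeasure Pr]
  {P : Fin K → Fin L → ℝ} {X : Fin K → ℕ → Ω → Fin L}

open Classical in
/-- The number of leader errors with leader count below `T`. -/
def leaderErrorCount (b : Fin K) (T : ℕ) (x : Fin K → ℕ → Fin L) : ℝ :=
  ∑ n ∈ Finset.range T, ∑ ℓ ∈ Finset.univ.erase b, ∑ m ∈ Finset.Icc 1 n,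
    if x ∈ leaderError b ℓ n m then 1 else 0

open Classical in
/-- The number of challenger errors with `M + j` pulls of the challenger, `j < T`, and leader count
below `T`. -/
def challengerErrorCount (P : Fin K → Fin L → ℝ) (b : Fin K) (M T : ℕ)
    (x : Fin K → ℕ → Fin L) : ℝ :=
  ∑ j ∈ Finset.range T, ∑ i ∈ Finset.univ.erase b, ∑ n ∈ Finset.range T,
    if M + j ≤ n ∧ x ∈ challengerError b i (gap P b i) n (M + j) then 1 else 0

lemma integrable_ite_and_integral_ite {p : Ω → Prop} [DecidablePred p]
    (hp : MeasurableSet {ω | p ω}) :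
    Integrable (fun ω => if p ω then (1 : ℝ) else 0) Pr ∧
      ∫ ω, (if p ω then (1 : ℝ) else 0) ∂Pr = Pr.real {ω | p ω} := by
  have h : (fun ω => if p ω then (1 : ℝ) else 0) = {ω | p ω}.indicator 1 := by
    ext ω
    simp [Set.indicator_apply]
  rw [h]
  exact ⟨(integrable_const (1 : ℝ)).indicator hp, integral_indicator_one hp⟩

lemma integral_leaderErrorCount_le (hK : 3 ≤ K) (hX : ∀ i m, Measurable (X i m))
    (hind : iIndepFun (fun p : Fin K × ℕ => X p.1 p.2) Pr)
    (hP : ∀ i m l, Pr.real {ω | X i m ω = l} = P i l) {b : Fin K}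
    (hgap : ∀ i, i ≠ b → 0 < gap P b i) (T : ℕ) :
    Integrable (fun ω => leaderErrorCount b T fun i q => X i q ω) Pr ∧
    ∫ ω, leaderErrorCount b T (fun i q => X i q ω) ∂Pr ≤ ∑ i ∈ Finset.univ.erase b,
      ((∑' n : ℕ, (n : ℝ) * Real.exp (-(gap P b i ^ 2 / 950 * n))) +
      (∑' n : ℕ, (n : ℝ) ^ (-(51 / 50) : ℝ)) *
        (∑' m : ℕ, Real.exp (-(gap P b i ^ 2 / 2 * m)))) := by
  classical
  have hite := fun ℓ n m => integrable_ite_and_integral_ite (Pr := Pr)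
    (measurableSet_leaderError hX b ℓ n m)
  have h1 : ∀ n ℓ, Integrable (fun ω => ∑ m ∈ Finset.Icc 1 n,
      if (fun i q => X i q ω) ∈ leaderError b ℓ n m then (1 : ℝ) else 0) Pr := fun n ℓ =>
    integrable_finsetSum _ fun m _ => (hite ℓ n m).1
  have h2 : ∀ n, Integrable (fun ω => ∑ ℓ ∈ Finset.univ.erase b, ∑ m ∈ Finset.Icc 1 n,
      if (fun i q => X i q ω) ∈ leaderError b ℓ n m then (1 : ℝ) else 0) Pr := fun n =>
    integrable_finsetSum _ fun ℓ _ => h1 n ℓ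
  unfold leaderErrorCount
  refine ⟨integrable_finsetSum _ fun n _ => h2 n, ?_⟩
  rw [integral_finsetSum _ fun n _ => h2 n]
  simp only [integral_finsetSum _ fun ℓ _ => h1 _ ℓ, integral_finsetSum _ fun m _ => (hite _ _ m).1,
    (hite _ _ _).2]
  rw [Finset.sum_comm]
  refine Finset.sum_le_sum fun ℓ hℓ => ?_
  have hℓb := Finset.ne_of_mem_erase hℓ
  refine le_trans ?_ (sum_leaderError_le (hgap ℓ hℓb) T)
  refine Finset.sum_le_sum fun n _ => Finset.sum_le_sum fun m hm => ?_
  rw [Finset.mem_Icc] at hm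
  exact measureReal_leaderError_le hK hX hind hP hℓb (hgap ℓ hℓb).le (by omega) hm.2

lemma integral_challengerErrorCount_le (hK : 3 ≤ K) (hX : ∀ i m, Measurable (X i m))
    (hind : iIndepFun (fun p : Fin K × ℕ => X p.1 p.2) Pr)
    (hP : ∀ i m l, Pr.real {ω | X i m ω = l} = P i l) {b : Fin K}
    {α : ℝ} (hα : 3 / 2 ≤ (((K : ℝ) - 2) / (K - 1)) ^ 2 * α)
    {δ : ℝ} (hδ : 0 < δ) (hδd : ∀ i, i ≠ b → δ ≤ gap P b i) {T M : ℕ} (hT : T ≠ 0) (hM0 : M ≠ 0)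
    (hM : 4 * α / δ ^ 2 * Real.log T ≤ M) :
    Integrable (fun ω => challengerErrorCount P b M T fun i q => X i q ω) Pr ∧
    ∫ ω, challengerErrorCount P b M T (fun i q => X i q ω) ∂Pr ≤ ∑ i ∈ Finset.univ.erase b,
      ∑' j : ℕ, Real.exp (-(gap P b i ^ 2 / 10 * j)) := by
  classical
  have hite := fun i n j => integrable_ite_and_integral_ite (Pr := Pr)
    (p := fun ω => M + j ≤ n ∧ (fun i q => X i q ω) ∈ challengerError b i (gap P b i) n (M + j))
    ((MeasurableSet.const _).inter (measurableSet_challengerError hX b i _ n (M + j)))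
  have h1 : ∀ j i, Integrable (fun ω => ∑ n ∈ Finset.range T,
      if M + j ≤ n ∧ (fun i q => X i q ω) ∈ challengerError b i (gap P b i) n (M + j)
        then (1 : ℝ) else 0) Pr := fun j i =>
    integrable_finsetSum _ fun n _ => (hite i n j).1
  have h2 : ∀ j, Integrable (fun ω => ∑ i ∈ Finset.univ.erase b, ∑ n ∈ Finset.range T,
      if M + j ≤ n ∧ (fun i q => X i q ω) ∈ challengerError b i (gap P b i) n (M + j)
        then (1 : ℝ) else 0) Pr := fun j =>
    integrable_finsetSum _ fun i _ => h1 j i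
  unfold challengerErrorCount
  refine ⟨integrable_finsetSum _ fun j _ => h2 j, ?_⟩
  rw [integral_finsetSum _ fun j _ => h2 j]
  simp only [integral_finsetSum _ fun i _ => h1 _ i, integral_finsetSum _ fun n _ => (hite _ n _).1,
    (hite _ _ _).2]
  rw [Finset.sum_comm]
  refine Finset.sum_le_sum fun i hi => ?_
  have hib := Finset.ne_of_mem_erase hi
  refine le_trans ?_ (sum_challengerError_le (hδ.trans_le (hδd i hib)) hT)
  refine Finset.sum_le_sum fun j _ => Finset.sum_le_sum fun n _ => ?_
  by_cases hn : M + j ≤ n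
  · simp only [hn, true_and]
    exact measureReal_challengerError_le hK hX hind hP hib hα hδ (hδd i hib) hT hM (by omega) hn
  · simp only [hn, false_and]
    simp
    positivity

end Table

/-! ### The regret bound -/

lemma pulls_le_add_errorCounts {K L : ℕ} (hK : 3 ≤ K) {α : ℝ}
    (hα : 3 / 2 ≤ (((K : ℝ) - 2) / (K - 1)) ^ 2 * α) {τ : ℕ} (hτ : 1 ≤ τ)
    {P : Fin K → Fin L → ℝ} {b : Fin K} {δ : ℝ} (hδ : 0 < δ) (hδd : ∀ i, i ≠ b → δ ≤ gap P b i)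
    {T M : ℕ} (hM : 4 * α / δ ^ 2 * Real.log T ≤ M) {x : Fin K → ℕ → Fin L} {a : ℕ → Fin K}
    (hrun : IsBordaUCBRun α τ a (feedback x a)) {i : Fin K} (hi : i ≠ b) :
    (pulls a T i : ℝ) ≤ τ + M + leaderErrorCount b T x + challengerErrorCount P b M T x := by
  classical
  have hα0 : 0 ≤ α := nonneg_of_three_halves_le hα
  set A : ℕ → ℝ := fun n => ∑ ℓ ∈ Finset.univ.erase b, ∑ m ∈ Finset.Icc 1 n,
    if x ∈ leaderError b ℓ n m then 1 else 0 with hA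
  set B' : ℕ → ℝ := fun m => ∑ i ∈ Finset.univ.erase b, ∑ n ∈ Finset.range T,
    if m ≤ n ∧ x ∈ challengerError b i (gap P b i) n m then 1 else 0 with hB'
  set B : ℕ → ℝ := fun m => if M ≤ m then B' m else 0 with hB
  have hB'0 : ∀ m, 0 ≤ B' m := fun m =>
    Finset.sum_nonneg fun i _ => Finset.sum_nonneg fun n _ => by split_ifs <;> norm_num
  have hA0 : ∀ n, 0 ≤ A n := fun n =>
    Finset.sum_nonneg fun i _ => Finset.sum_nonneg fun n _ => by split_ifs <;> norm_num
  have hB0 : ∀ m, 0 ≤ B m := fun m => by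
    simp only [hB]
    split_ifs
    exacts [hB'0 m, le_rfl]
  have h := pulls_le_of_run hrun b T M hA0 hB0 ?_ ?_ hi
  · refine h.trans (add_le_add le_rfl ?_)
    have h1 : challengerErrorCount P b M T x = ∑ j ∈ Finset.range T, B' (M + j) := rfl
    have h2 : ∀ j, B (M + j) = B' (M + j) := fun j => if_pos (Nat.le_add_right _ _)
    have h3 : ∑ m ∈ Finset.range M, B m = 0 := Finset.sum_eq_zero fun m hm => by
      simp only [hB]
      rw [if_neg (by simpa using hm)]
    calc ∑ m ∈ Finset.range T, B m ≤ ∑ m ∈ Finset.range (M + T), B m :=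
          Finset.sum_le_sum_of_subset_of_nonneg (Finset.range_mono (Nat.le_add_left _ _))
            fun m _ _ => hB0 m
      _ = challengerErrorCount P b M T x := by
          rw [Finset.sum_range_add, h3, zero_add, h1]
          exact Finset.sum_congr rfl fun j _ => h2 j
  · intro t ℓ n m htT hℓ hτm hmn hp hu
    have hx := mem_leaderError_of_ucb_le hK hα hℓ.symm (by omega) hmn hp (hu b)
    calc (1 : ℝ) = if x ∈ leaderError b ℓ n m then 1 else 0 := (if_pos hx).symm
      _ ≤ ∑ m ∈ Finset.Icc 1 n, if x ∈ leaderError b ℓ n m then 1 else 0 :=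
          Finset.single_le_sum (f := fun m => if x ∈ leaderError b ℓ n m then (1 : ℝ) else 0)
            (fun m _ => by split_ifs <;> norm_num) (Finset.mem_Icc.2 ⟨by omega, hmn⟩)
      _ ≤ A n := Finset.single_le_sum (f := fun ℓ => ∑ m ∈ Finset.Icc 1 n,
            if x ∈ leaderError b ℓ n m then (1 : ℝ) else 0)
            (fun ℓ _ => Finset.sum_nonneg fun m _ => by split_ifs <;> norm_num)
            (by simpa using hℓ)
  · intro t u n m htT hub hτm hmn hMm hp hu
    have hMm' : 4 * α / δ ^ 2 * Real.log T ≤ m := hM.trans (by exact_mod_cast hMm)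
    have hx := mem_challengerError_of_ucb_le hK hα0 hub hδ (hδd u hub) htT (by omega) hMm' hp (hu b)
    have hnT : n ∈ Finset.range T := by
      have h1 := pulls_le a t b
      rw [hp, leaderCount_self] at h1
      exact Finset.mem_range.2 (by omega)
    simp only [hB, if_pos hMm]
    calc (1 : ℝ) = if m ≤ n ∧ x ∈ challengerError b u (gap P b u) n m then 1 else 0 :=
          (if_pos ⟨hmn.le, hx⟩).symm
      _ ≤ ∑ n ∈ Finset.range T,
          if m ≤ n ∧ x ∈ challengerError b u (gap P b u) n m then 1 else 0 :=
          Finset.single_le_sum (f := fun n =>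
            if m ≤ n ∧ x ∈ challengerError b u (gap P b u) n m then (1 : ℝ) else 0)
            (fun m _ => by split_ifs <;> norm_num) hnT
      _ ≤ B' m := Finset.single_le_sum (f := fun i => ∑ n ∈ Finset.range T,
            if m ≤ n ∧ x ∈ challengerError b i (gap P b i) n m then (1 : ℝ) else 0)
            (fun ℓ _ => Finset.sum_nonneg fun m _ => by split_ifs <;> norm_num)
            (by simpa using hub)

lemma gapMin_le {K L : ℕ} (P : Fin K → Fin L → ℝ) {b i : Fin K} (hi : i ≠ b) :
    gapMin P b ≤ gap P b i :=
  ciInf_le (Set.finite_range _).bddBelow (⟨i, hi⟩ : {i : Fin K // i ≠ b})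

theorem integral_regret_le {K L : ℕ} (hK : 3 ≤ K) {α : ℝ}
    (hα : 3 / 2 ≤ (((K : ℝ) - 2) / (K - 1)) ^ 2 * α) {τ : ℕ} (hτ : 1 ≤ τ)
    {P : Fin K → Fin L → ℝ} {b : Fin K} {δ : ℝ} (hδ : 0 < δ) (hδd : ∀ i, i ≠ b → δ ≤ gap P b i)
    {Ω : Type*} [MeasurableSpace Ω] {Pr : Measure Ω} [IsProbabilityMeasure Pr]
    {X : Fin K → ℕ → Ω → Fin L} (hX : ∀ i m, Measurable (X i m))
    (hind : iIndepFun (fun p : Fin K × ℕ => X p.1 p.2) Pr)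
    (hP : ∀ i m l, Pr.real {ω | X i m ω = l} = P i l) {a : ℕ → Ω → Fin K}
    (hrun : ∀ᵐ ω ∂Pr, IsBordaUCBRun α τ (fun t => a t ω)
      (feedback (fun i m => X i m ω) (fun t => a t ω))) (T : ℕ) :
    ∫ ω, regret P b (fun t => a t ω) T ∂Pr ≤ gapAll P b *
      (4 * α / δ ^ 2 * Real.log T + (τ + 2) + ∑ i, errorBound (gap P b i)) := by
  have hα0 : 0 ≤ α := nonneg_of_three_halves_le hα
  have hgap : ∀ i, i ≠ b → 0 < gap P b i := fun i hi => hδ.trans_le (hδd i hi)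
  have hall : 0 ≤ gapAll P b :=
    Finset.sum_nonneg fun i hi => (hgap i (Finset.ne_of_mem_erase hi)).le
  have herr : 0 ≤ ∑ i, errorBound (gap P b i) := Finset.sum_nonneg fun i _ => errorBound_nonneg _
  have hlog0 : 0 ≤ 4 * α / δ ^ 2 * Real.log T :=
    mul_nonneg (by positivity) (Real.log_natCast_nonneg T)
  rcases eq_or_ne T 0 with rfl | hT
  · simp only [regret, Finset.range_zero, Finset.sum_empty, integral_zero]
    exact mul_nonneg hall (by positivity)
  -- The summand `1` keeps the sample sizes in the challenger errors positive.
  set M := ⌈4 * α / δ ^ 2 * Real.log T⌉₊ + 1 with hMdef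
  have hM : 4 * α / δ ^ 2 * Real.log T ≤ M := by
    rw [hMdef]
    push_cast
    linarith [Nat.le_ceil (4 * α / δ ^ 2 * Real.log T)]
  have hM' : (M : ℝ) ≤ 4 * α / δ ^ 2 * Real.log T + 2 := by
    rw [hMdef]
    push_cast
    linarith [Nat.ceil_lt_add_one hlog0]
  obtain ⟨hAi, hA⟩ := integral_leaderErrorCount_le hK hX hind hP hgap T
  obtain ⟨hBi, hB⟩ := integral_challengerErrorCount_le hK hX hind hP hα hδ hδd hT
    (show M ≠ 0 from Nat.succ_ne_zero _) hM
  have hci : Integrable (fun _ : Ω => (τ : ℝ) + M) Pr := integrable_const _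
  have hcA : Integrable (fun ω => (τ : ℝ) + M + leaderErrorCount b T (fun i q => X i q ω)) Pr :=
    hci.add hAi
  have hcount : ∫ ω, ((τ : ℝ) + M + leaderErrorCount b T (fun i q => X i q ω) +
      challengerErrorCount P b M T (fun i q => X i q ω)) ∂Pr ≤
      4 * α / δ ^ 2 * Real.log T + (τ + 2) + ∑ i, errorBound (gap P b i) := by
    rw [integral_add hcA hBi, integral_add hci hAi, integral_const, probReal_univ,
      one_smul]
    have h1 : ∑ i ∈ Finset.univ.erase b, errorBound (gap P b i) ≤
        ∑ i, errorBound (gap P b i) :=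
      Finset.sum_le_sum_of_subset_of_nonneg (Finset.erase_subset _ _)
        fun i _ _ => errorBound_nonneg _
    have h2 := add_le_add hA hB
    rw [← Finset.sum_add_distrib] at h2
    simp only [errorBound] at h1 ⊢
    linarith
  refine le_trans ?_ (mul_le_mul_of_nonneg_left hcount hall)
  rw [← integral_const_mul]
  refine integral_mono_of_nonneg (ae_of_all _ fun ω => ?_)
    ((hcA.add hBi).const_mul _) ?_
  · simp only [Pi.zero_apply, regret_eq_sum_pulls]
    exact Finset.sum_nonneg fun i hi =>
      mul_nonneg (hgap i (Finset.ne_of_mem_erase hi)).le (Nat.cast_nonneg _)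
  · filter_upwards [hrun] with ω hω
    simp only [regret_eq_sum_pulls]
    rw [gapAll, Finset.sum_mul]
    refine Finset.sum_le_sum fun i hi => ?_
    have hib := Finset.ne_of_mem_erase hi
    exact mul_le_mul_of_nonneg_left
      (pulls_le_add_errorCounts hK hα hτ hδ hδd hM hω hib) (hgap i hib).le

end QDB

end

theorem theorem3 (K L τ : ℕ) (hK : 3 ≤ K) (hτ : 1 ≤ τ) :
    ∃ (C : ℝ → ℝ) (C' : (Fin K → ℝ) → ℝ → ℝ),
      (C =O[𝓝[>] (0 : ℝ)] fun ε => 1 / ε ^ 2) ∧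
      (∀ δ : Fin K → ℝ, C' δ =O[𝓝[>] (0 : ℝ)] fun ε' => 1 / ε' ^ 2) ∧
      ∀ P : Fin K → Fin L → ℝ, (∀ i, P i ∈ stdSimplex ℝ (Fin L)) →
      ∀ b : Fin K, QDB.IsBordaWinner P b →
      ∀ ε' : ℝ, 0 < ε' → ε' ≠ 1 →
      ∀ ε : ℝ, 0 < ε → 2 * ε < QDB.gapMin P b →
      ∀ (Ω : Type*) [MeasurableSpace Ω] (Pr : Measure Ω) [IsProbabilityMeasure Pr]
        (X : Fin K → ℕ → Ω → Fin L),
        (∀ i m, Measurable (X i m)) →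
        iIndepFun (fun p : Fin K × ℕ => X p.1 p.2) Pr →
        (∀ i m l, Pr.real {ω | X i m ω = l} = P i l) →
      ∀ a : ℕ → Ω → Fin K, (∀ t, Measurable (a t)) →
        (∀ᵐ ω ∂Pr, QDB.IsBordaUCBRun (QDB.bordaAlpha K ε') τ (fun t => a t ω)
          (QDB.feedback (fun i m => X i m ω) (fun t => a t ω))) →
      ∀ T : ℕ,
        ∫ ω, QDB.regret P b (fun t => a t ω) T ∂Pr ≤
          QDB.gapAll P b *
            (4 * QDB.bordaAlpha K ε' / (QDB.gapMin P b - 2 * ε) ^ 2 * Real.log T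
              + C ε + C' (QDB.gap P b) ε') := by
  have hO : ∀ c : ℝ, (fun _ : ℝ => c) =O[𝓝[>] (0 : ℝ)] fun ε => 1 / ε ^ 2 := by
    intro c
    refine IsBigO.of_bound |c| ?_
    filter_upwards [Ioo_mem_nhdsGT (show (0 : ℝ) < 1 by norm_num)] with ε hε
    have h1 : (1 : ℝ) ≤ 1 / ε ^ 2 := by
      rw [le_div_iff₀ (pow_pos hε.1 2), one_mul]
      exact pow_le_one₀ hε.1.le hε.2.le
    rw [Real.norm_eq_abs, Real.norm_of_nonneg (by linarith)]
    exact le_mul_of_one_le_right (abs_nonneg c) h1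
  refine ⟨fun _ => τ + 2, fun δ _ => ∑ i, QDB.errorBound (δ i), hO _, fun δ => hO _, ?_⟩
  intro P _ b _ ε' hε' hε'1 ε hε hgap Ω _ Pr _ X hX hind hP a _ hrun T
  exact QDB.integral_regret_le hK (QDB.three_halves_le_mul_bordaAlpha hK hε' hε'1) hτ
    (sub_pos.2 hgap) (fun i hi => by linarith [QDB.gapMin_le P hi]) hX hind hP hrun T
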